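/- Let $\Omega\subset\mathbb C^n$ be a smoothly bounded strongly pseudoconvex domain and let $r$ be a defining function of $\Omega$ that is smooth and strictly plurisubharmonic on (a neighbourhood of) $\overline\Omega$: thus $\Omega$ is bounded, open and connected, $r$ is smooth on an open set $U\supset\overline\Omega$, $\Omega=\{z\in U: r(z)<0\}$, $dr\neq 0$ on $\partial\Omega$, and the matrix $(\partial^2 r/\partial z^\alpha\partial\bar z^\beta)$ is positive definite on $\overline\Omega$. Put $\omega=i\partial\bar\partial(-\log(-r))$ on $\Omega$. Let $0<T\le\infty$ and let $\omega(t)=i\partial\bar\partial g(t)$, $t\in[0,T)$, with $g$ a smooth real function on $\Omega\times[0,T)$, be Kähler metrics on $\Omega$ solving the normalized Kähler–Ricci flow $$\frac{\partial}{\partial t}\omega(t)=-\mathrm{Ric}(\omega(t))-(n+1)\,\omega(t),\qquad \omega(0)=\omega ,$$ where $\mathrm{Ric}(\omega(t))=-i\partial\bar\partial\log\det(g(t)_{\alpha\bar\beta})$ and $g(t)_{\alpha\bar\beta}=\partial^2 g(t)/\partial z^\alpha\partial\bar z^\beta$, and such that $\frac1C\,\omega\le\omega(t)\le C\,\omega$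 on $\Omega$ for all $t\in[0,T)$, with a constant $C>0$ independent of $t$. Write $\Delta_t=g(t)^{\alpha\bar\beta}\,\partial^2/\partial z^\alpha\partial\bar z^\beta$ for the Laplacian and $dV_t=\omega(t)^n/n!$ for the volume form of $\omega(t)$. Let $f$ be a smooth real function on $\Omega\times[0,T)$ satisfying $$\Big(\frac{\partial}{\partial t}-\Delta_t\Big)f\ge 0\quad\text{at every point of }\Omega\times[0,T)\text{ where } f\le 0 .$$ Assume that there exists a constant $b>0$ such that $$\int_0^T\!\!\int_\Omega(-r)^b\,(f_-)^2\,dV_t\,dt<\infty,\qquad f_-:=-\min\{f,0\}.$$ If $f\ge 0$ on $\Omega$ at $t=0$, then $f\ge 0$ on $\Omega\times[0,T)$. -/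

import Mathlib

open scoped ContDiff ComplexOrder

noncomputable section

namespace KRFMax

/-- The Wirtinger derivative `∂h/∂z^α = (1/2) (∂/∂x^α - i ∂/∂y^α) h` on `ℂⁿ`. -/
def dz {n : ℕ} (α : Fin n) (h : (Fin n → ℂ) → ℂ) (z : Fin n → ℂ) : ℂ :=
  (1 / 2 : ℂ) * (fderiv ℝ h z (Pi.single α 1) - Complex.I * fderiv ℝ h z (Pi.single α Complex.I))

/-- The conjugate Wirtinger derivative `∂h/∂z̄^β = (1/2) (∂/∂x^β + i ∂/∂y^β) h` on `ℂⁿ`. -/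
def dzbar {n : ℕ} (β : Fin n) (h : (Fin n → ℂ) → ℂ) (z : Fin n → ℂ) : ℂ :=
  (1 / 2 : ℂ) * (fderiv ℝ h z (Pi.single β 1) + Complex.I * fderiv ℝ h z (Pi.single β Complex.I))

/-- The complex Hessian `(h_{αβ̄})` of a real function `h`: the coefficient matrix of `i∂∂̄h`. -/
def complexHessian {n : ℕ} (h : (Fin n → ℂ) → ℝ) (z : Fin n → ℂ) : Matrix (Fin n) (Fin n) ℂ :=
  Matrix.of fun α β => dz α (dzbar β (fun w => ((h w : ℝ) : ℂ))) z

/-- `r` is a smooth defining function of the bounded domain `Ω ⊂ ℂⁿ` that is strictly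
plurisubharmonic on the closure of `Ω`. In particular `Ω` is a smoothly bounded strongly
pseudoconvex domain, and every such domain has such a defining function. -/
structure IsStrictlyPshDefiningFunction {n : ℕ} (Ω : Set (Fin n → ℂ)) (r : (Fin n → ℂ) → ℝ) :
    Prop where
  isOpen : IsOpen Ω
  isConnected : IsConnected Ω
  isBounded : Bornology.IsBounded Ω
  /-- `r` is smooth on a neighbourhood `U` of the closure, and `Ω` is where `r < 0` in `U`. -/
  exists_nhd : ∃ U : Set (Fin n → ℂ), IsOpen U ∧ closure Ω ⊆ U ∧ ContDiffOn ℝ ∞ r U ∧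
    Ω = {z ∈ U | r z < 0}
  fderiv_ne_zero : ∀ z ∈ frontier Ω, fderiv ℝ r z ≠ 0
  posDef : ∀ z ∈ closure Ω, (complexHessian r z).PosDef

/-- The time interval `[0, T)`, where `T` may be `∞`. -/
def timeInterval (T : EReal) : Set ℝ := {t : ℝ | 0 ≤ t ∧ (t : EReal) < T}

/-- The potential `-log(-r)` of the reference metric `ω`. -/
def refPotential {n : ℕ} (r : (Fin n → ℂ) → ℝ) (z : Fin n → ℂ) : ℝ := -Real.log (-r z)

/-- The coefficient matrix `(g_{αβ̄})` of the reference form `ω = i∂∂̄(-log(-r))`. -/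
def refMetric {n : ℕ} (r : (Fin n → ℂ) → ℝ) (z : Fin n → ℂ) : Matrix (Fin n) (Fin n) ℂ :=
  complexHessian (refPotential r) z

/-- The coefficient matrix `(g(t)_{αβ̄})` of the form `ω(t) = i∂∂̄g(t)` with potential
`g(t) = g · t`. -/
def metric {n : ℕ} (g : (Fin n → ℂ) → ℝ → ℝ) (t : ℝ) (z : Fin n → ℂ) :
    Matrix (Fin n) (Fin n) ℂ :=
  complexHessian (fun w => g w t) z

/-- The coefficient matrix of the Ricci form `-i∂∂̄ log det(G_{αβ̄})` of the metric with
coefficients `G`. -/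
def ricci {n : ℕ} (G : (Fin n → ℂ) → Matrix (Fin n) (Fin n) ℂ) (z : Fin n → ℂ) :
    Matrix (Fin n) (Fin n) ℂ :=
  -complexHessian (fun w => Real.log (G w).det.re) z

/-- The Laplacian `G^{αβ̄} h_{αβ̄}` of a real function `h` with respect to the metric `G`. -/
def laplacian {n : ℕ} (G : (Fin n → ℂ) → Matrix (Fin n) (Fin n) ℂ) (h : (Fin n → ℂ) → ℝ)
    (z : Fin n → ℂ) : ℝ :=
  ((G z)⁻¹ * complexHessian h z).trace.re

/-- The volume form `ω_Gⁿ / n!` on `Ω` of `ω_G = i G_{αβ̄} dz^α ∧ dz̄^β`, which is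
`2ⁿ det(G_{αβ̄})` times Lebesgue measure because `i dz ∧ dz̄ = 2 dx ∧ dy`. -/
def volumeForm {n : ℕ} (Ω : Set (Fin n → ℂ)) (G : (Fin n → ℂ) → Matrix (Fin n) (Fin n) ℂ) :
    MeasureTheory.Measure (Fin n → ℂ) :=
  (MeasureTheory.volume.restrict Ω).withDensity
    fun z => ENNReal.ofReal ((2 : ℝ) ^ n * (G z).det.re)

/-- `ω(t) = i∂∂̄g(t)`, `t ∈ [0, T)`, is a smooth family of Kähler metrics on `Ω` solving the
normalized Kähler–Ricci flow `∂ω(t)/∂t = -Ric(ω(t)) - (n+1) ω(t)` with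
`ω(0) = i∂∂̄(-log(-r))`. -/
structure IsKahlerRicciFlow {n : ℕ} (Ω : Set (Fin n → ℂ)) (r : (Fin n → ℂ) → ℝ) (T : EReal)
    (g : (Fin n → ℂ) → ℝ → ℝ) : Prop where
  smooth : ContDiffOn ℝ ∞ (fun p : (Fin n → ℂ) × ℝ => g p.1 p.2) (Ω ×ˢ timeInterval T)
  posDef : ∀ t ∈ timeInterval T, ∀ z ∈ Ω, (metric g t z).PosDef
  initial : ∀ z ∈ Ω, metric g 0 z = refMetric r z
  evolution : ∀ t ∈ timeInterval T, ∀ z ∈ Ω, ∀ α β : Fin n,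
    HasDerivWithinAt (fun s => metric g s z α β)
      (-(ricci (metric g t) z α β) - ((n : ℂ) + 1) * metric g t z α β) (timeInterval T) t

/-- `(1/C) ω ≤ ω(t) ≤ C ω` on `Ω` with a constant `C > 0` independent of `t ∈ [0, T)`, where
`ω = i∂∂̄(-log(-r))` and `ω(t) = i∂∂̄g(t)`. -/
def IsQuasiIsometric {n : ℕ} (Ω : Set (Fin n → ℂ)) (r : (Fin n → ℂ) → ℝ) (T : EReal)
    (g : (Fin n → ℂ) → ℝ → ℝ) : Prop :=
  ∃ C : ℝ, 0 < C ∧ ∀ t ∈ timeInterval T, ∀ z ∈ Ω,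
    (metric g t z - ((1 / C : ℝ) : ℂ) • refMetric r z).PosSemidef ∧
    ((C : ℂ) • refMetric r z - metric g t z).PosSemidef

end KRFMax

end

/-! The proof is a weighted energy estimate for the negative part of `f`. A convex nonincreasing
`C²` function of `f` that vanishes for `f ≥ 0` (`negPenalty`) gives a subsolution `v`, that is `∂_t
v ≤ Δ_t v`. With `φ = -log(-r)`, put `E(t) = ∫ (-r)^b v det g(t)`, the weight being `e^{-bφ}`. The
Laplacian is symmetric for the volume form, so it can be moved from `v` to the weight. If the
Laplacian of the weight is at most a constant times the weight, and if the rate `s = ∂_t log det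
g(t)` is bounded above, then `E(t) ≤ c ∫₀ᵗ E`. The growth hypothesis makes `E` integrable in time,
Grönwall's lemma gives `E = 0`, and hence `f ≥ 0`.

The weight: `ω` dominates `∂φ ∧ ∂̄φ`, so quasi-isometry bounds both `Δ_t φ` and `|∂φ|²` in the
metric `ω(t)` (`exists_laplacian_comp_refPotential`). The sublevel sets of `φ` are compact, and the
cutoffs `((e^{-aφ} - ε)₊)³` with `a = b/3` make every integration by parts legitimate; `ε → 0` is
Fatou's lemma (`exists_lintegral_expCutoff_le`).

The volume rate: no curvature bound is assumed, but `s` is minus the scalar curvature up to a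
constant, and `∂_t s ≤ Δ_t s - s²/(n+1) - (n+1)s`. The quadratic term beats the barrier `A + M/(R -
φ)²`, which blows up where `φ = R`; letting `R → ∞` gives `s ≤ A` (`exists_volumeRate_le`). The
bound at `t = 0` comes from `det ω = (-r)^{-(n+1)} J` with `J` smooth and positive up to the
boundary. -/

noncomputable section

namespace KRFMax

open Topology Filter Set MeasureTheory

variable {n : ℕ}

/-! ### Wirtinger calculus and the complex Hessian -/

/-- The functional `L ↦ (1/2) (L(e_α) + c L(i e_α))` on real-linear maps `ℂⁿ → ℂ`. -/
def wirtingerForm (c : ℂ) (α : Fin n) : ((Fin n → ℂ) →L[ℝ] ℂ) →ₗ[ℂ] ℂ where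
  toFun L := (1 / 2 : ℂ) * (L (Pi.single α 1) + c * L (Pi.single α Complex.I))
  map_add' L M := by simp only [add_apply]; ring
  map_smul' a L := by
    simp only [smul_apply, smul_eq_mul, RingHom.id_apply]; ring

/-- The first order operator `(1/2) (∂/∂x^α + c ∂/∂y^α)`: `∂/∂z^α` for `c = -i` and `∂/∂z̄^α`
for `c = i`. -/
def wirtinger (c : ℂ) (α : Fin n) (h : (Fin n → ℂ) → ℂ) (z : Fin n → ℂ) : ℂ :=
  wirtingerForm c α (fderiv ℝ h z)

theorem dz_eq_wirtinger (α : Fin n) : dz α = wirtinger (-Complex.I) α := by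
  funext h z
  simp only [dz, wirtinger, wirtingerForm, LinearMap.coe_mk, AddHom.coe_mk]
  ring

theorem dzbar_eq_wirtinger (α : Fin n) : dzbar α = wirtinger Complex.I α := by
  funext h z
  simp only [dzbar, wirtinger, wirtingerForm, LinearMap.coe_mk, AddHom.coe_mk]

theorem complexHessian_apply (h : (Fin n → ℂ) → ℝ) (z : Fin n → ℂ) (α β : Fin n) :
    complexHessian h z α β =
      wirtinger (-Complex.I) α (wirtinger Complex.I β (fun w => (h w : ℂ))) z := by
  simp [complexHessian, dz_eq_wirtinger, dzbar_eq_wirtinger]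

section

variable {c d : ℂ} {α β : Fin n} {h k : (Fin n → ℂ) → ℂ} {z : Fin n → ℂ}

theorem wirtinger_congr (e : h =ᶠ[𝓝 z] k) : wirtinger c α h z = wirtinger c α k z := by
  simp only [wirtinger, e.fderiv_eq]

theorem wirtinger_congr_nhds (e : h =ᶠ[𝓝 z] k) :
    wirtinger c α h =ᶠ[𝓝 z] wirtinger c α k := by
  filter_upwards [e.eventuallyEq_nhds] with w hw using wirtinger_congr hw

theorem wirtinger_const (a : ℂ) : wirtinger c α (fun _ => a) z = 0 := by
  simp [wirtinger]

theorem wirtinger_add (hh : DifferentiableAt ℝ h z) (hk : DifferentiableAt ℝ k z) :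
    wirtinger c α (fun w => h w + k w) z = wirtinger c α h z + wirtinger c α k z := by
  simp only [wirtinger, fderiv_fun_add hh hk, map_add]

theorem wirtinger_mul (hh : DifferentiableAt ℝ h z) (hk : DifferentiableAt ℝ k z) :
    wirtinger c α (fun w => h w * k w) z =
      h z * wirtinger c α k z + wirtinger c α h z * k z := by
  simp only [wirtinger, fderiv_fun_mul hh hk, map_add, map_smul, smul_eq_mul]
  ring

theorem wirtinger_const_mul (a : ℂ) (hk : DifferentiableAt ℝ k z) :
    wirtinger c α (fun w => a * k w) z = a * wirtinger c α k z := by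
  rw [wirtinger_mul (differentiableAt_const a) hk, wirtinger_const]; ring

theorem wirtinger_sum {ι : Type*} {s : Finset ι} {H : ι → (Fin n → ℂ) → ℂ}
    (hH : ∀ i ∈ s, DifferentiableAt ℝ (H i) z) :
    wirtinger c α (fun w => ∑ i ∈ s, H i w) z = ∑ i ∈ s, wirtinger c α (H i) z := by
  simp only [wirtinger, fderiv_fun_sum hH, map_sum]

theorem contDiffAt_wirtinger {m k : ℕ∞ω} (hh : ContDiffAt ℝ k h z) (hm : m + 1 ≤ k) :
    ContDiffAt ℝ m (wirtinger c α h) z := by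
  have h1 : ContDiffAt ℝ m (fderiv ℝ h) z := hh.fderiv_right hm
  change ContDiffAt ℝ m (fun w => (1 / 2 : ℂ) * (fderiv ℝ h w (Pi.single α 1) +
    c * fderiv ℝ h w (Pi.single α Complex.I))) z
  fun_prop

theorem wirtinger_comm (hh : ContDiffAt ℝ 2 h z) :
    wirtinger c α (wirtinger d β h) z = wirtinger d β (wirtinger c α h) z := by
  have hd : DifferentiableAt ℝ (fderiv ℝ h) z :=
    (hh.fderiv_right (m := 1) (by norm_num)).differentiableAt (by norm_num)
  have hsym : ∀ u v, fderiv ℝ (fderiv ℝ h) z u v = fderiv ℝ (fderiv ℝ h) z v u :=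
    fun u v => (hh.isSymmSndFDerivAt (by simp)).eq u v
  have key : ∀ (e : ℂ) (γ : Fin n) (u : Fin n → ℂ), fderiv ℝ (wirtinger e γ h) z u =
      (1 / 2 : ℂ) * (fderiv ℝ (fderiv ℝ h) z u (Pi.single γ 1) +
        e * fderiv ℝ (fderiv ℝ h) z u (Pi.single γ Complex.I)) := by
    intro e γ u
    have h1 : ∀ v : Fin n → ℂ, HasFDerivAt (fun w => fderiv ℝ h w v)
        ((fderiv ℝ (fderiv ℝ h) z).flip v) z := fun v => by
      have := hd.hasFDerivAt.clm_apply (hasFDerivAt_const v z)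
      refine this.congr_fderiv ?_
      ext; simp
    have h2 := (((h1 (Pi.single γ 1)).add ((h1 (Pi.single γ Complex.I)).const_mul e)).const_mul
      (1 / 2 : ℂ))
    have h3 : wirtinger e γ h = fun w => (1 / 2 : ℂ) * (fderiv ℝ h w (Pi.single γ 1) +
        e * fderiv ℝ h w (Pi.single γ Complex.I)) := rfl
    rw [h3]
    erw [h2.fderiv]
    simp [mul_add]
  have expand : ∀ (e : ℂ) (γ : Fin n) (H : (Fin n → ℂ) → ℂ), wirtinger e γ H z =
      (1 / 2 : ℂ) * (fderiv ℝ H z (Pi.single γ 1) +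
        e * fderiv ℝ H z (Pi.single γ Complex.I)) := fun _ _ _ => rfl
  rw [expand, expand, key, key, key, key, hsym (Pi.single β 1) (Pi.single α 1),
    hsym (Pi.single β 1) (Pi.single α Complex.I), hsym (Pi.single β Complex.I) (Pi.single α 1),
    hsym (Pi.single β Complex.I) (Pi.single α Complex.I)]
  ring

theorem star_wirtinger : star (wirtinger c α h z) = wirtinger (star c) α (fun w => star (h w)) z := by
  have h1 : fderiv ℝ (fun w => star (h w)) z =
      (Complex.conjCLE : ℂ →L[ℝ] ℂ).comp (fderiv ℝ h z) :=
    Complex.conjCLE.comp_fderiv (f := h) (x := z)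
  simp only [wirtinger, wirtingerForm, LinearMap.coe_mk, AddHom.coe_mk, h1]
  simp

end

section

variable {f : (Fin n → ℂ) → ℝ} {z : Fin n → ℂ} {c : ℂ} {α : Fin n}

theorem star_wirtinger_ofReal :
    star (wirtinger c α (fun w => (f w : ℂ)) z) = wirtinger (star c) α (fun w => (f w : ℂ)) z := by
  rw [star_wirtinger]; simp

theorem contDiffAt_ofReal {k : ℕ∞ω} (hf : ContDiffAt ℝ k f z) :
    ContDiffAt ℝ k (fun w => (f w : ℂ)) z :=
  Complex.ofRealCLM.contDiff.contDiffAt.comp z hf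

theorem wirtinger_comp {p : ℝ → ℝ} {p' : ℝ} (hp : HasDerivAt p p' (f z))
    (hf : DifferentiableAt ℝ f z) :
    wirtinger c α (fun w => ((p (f w) : ℝ) : ℂ)) z = p' * wirtinger c α (fun w => (f w : ℂ)) z := by
  have h1 : HasFDerivAt (fun w => (f w : ℂ)) (Complex.ofRealCLM.comp (fderiv ℝ f z)) z :=
    Complex.ofRealCLM.hasFDerivAt.comp z hf.hasFDerivAt
  have h2 : HasFDerivAt (fun w => ((p (f w) : ℝ) : ℂ))
      (Complex.ofRealCLM.comp (p' • fderiv ℝ f z)) z :=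
    Complex.ofRealCLM.hasFDerivAt.comp z (hp.comp_hasFDerivAt z hf.hasFDerivAt)
  rw [wirtinger, wirtinger, h1.fderiv, h2.fderiv, ← smul_eq_mul, ← map_smul]
  congr 1
  ext u
  simp

/-- Conjugation exchanges `∂` and `∂̄` on a real function, and the two commute by symmetry of the
second derivative. -/
theorem complexHessian_isHermitian (hf : ContDiffAt ℝ 2 f z) : (complexHessian f z).IsHermitian := by
  ext α β
  rw [Matrix.conjTranspose_apply, complexHessian_apply, complexHessian_apply, star_wirtinger,
    wirtinger_comm (contDiffAt_ofReal hf)]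
  simp only [star_wirtinger_ofReal]
  simp

theorem complexHessian_congr {k : (Fin n → ℂ) → ℝ} (e : f =ᶠ[𝓝 z] k) :
    complexHessian f z = complexHessian k z := by
  ext α β
  rw [complexHessian_apply, complexHessian_apply]
  refine wirtinger_congr (wirtinger_congr_nhds ?_)
  filter_upwards [e] with w hw using by rw [hw]

/-- The vector `(∂f/∂z^α)` of a real function `f`. -/
def complexGradient (f : (Fin n → ℂ) → ℝ) (z : Fin n → ℂ) : Fin n → ℂ :=
  fun α => wirtinger (-Complex.I) α (fun w => (f w : ℂ)) z

/-- The chain rule `∂∂̄ p(f) = p'(f) ∂∂̄f + p''(f) ∂f ∧ ∂̄f`. -/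
theorem complexHessian_comp {p p' : ℝ → ℝ} {p'' : ℝ} (hf : ContDiffAt ℝ 2 f z)
    (hp : ∀ᶠ x in 𝓝 (f z), HasDerivAt p (p' x) x) (hp' : HasDerivAt p' p'' (f z)) :
    complexHessian (fun w => p (f w)) z = (p' (f z) : ℂ) • complexHessian f z +
      (p'' : ℂ) • Matrix.vecMulVec (complexGradient f z) (star (complexGradient f z)) := by
  have hd : ∀ᶠ w in 𝓝 z, DifferentiableAt ℝ f w :=
    (hf.eventually (by simp)).mono fun w hw => hw.differentiableAt (by norm_num)
  have hp2 : ∀ᶠ w in 𝓝 z, HasDerivAt p (p' (f w)) (f w) := hf.continuousAt.eventually hp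
  ext α β
  have e : wirtinger Complex.I β (fun w => ((p (f w) : ℝ) : ℂ)) =ᶠ[𝓝 z]
      fun w => ((p' (f w) : ℝ) : ℂ) * wirtinger Complex.I β (fun w => (f w : ℂ)) w := by
    filter_upwards [hd, hp2] with w h1 h2 using wirtinger_comp h2 h1
  have hfd : DifferentiableAt ℝ f z := hd.self_of_nhds
  have hpd : DifferentiableAt ℝ (fun w => ((p' (f w) : ℝ) : ℂ)) z :=
    Complex.ofRealCLM.differentiableAt.comp z (hp'.differentiableAt.comp z hfd)
  rw [complexHessian_apply, wirtinger_congr e, wirtinger_mul hpd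
    ((contDiffAt_wirtinger (m := 1) (contDiffAt_ofReal hf) (by norm_num)).differentiableAt
      (by norm_num)), wirtinger_comp hp' hfd]
  simp only [Matrix.add_apply, Matrix.smul_apply, Matrix.vecMulVec_apply, complexHessian_apply,
    complexGradient, Pi.star_apply, smul_eq_mul, star_wirtinger_ofReal]
  simp
  ring

theorem complexHessian_add {k : (Fin n → ℂ) → ℝ} (hf : ContDiffAt ℝ 2 f z)
    (hk : ContDiffAt ℝ 2 k z) :
    complexHessian (fun w => f w + k w) z = complexHessian f z + complexHessian k z := by
  have hd : ∀ {f : (Fin n → ℂ) → ℝ}, ContDiffAt ℝ 2 f z →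
      ∀ᶠ w in 𝓝 z, DifferentiableAt ℝ (fun w => (f w : ℂ)) w := fun hf =>
    ((contDiffAt_ofReal hf).eventually (by simp)).mono fun w hw => hw.differentiableAt (by norm_num)
  have hw : ∀ {f : (Fin n → ℂ) → ℝ} (β : Fin n), ContDiffAt ℝ 2 f z →
      DifferentiableAt ℝ (wirtinger Complex.I β (fun w => (f w : ℂ))) z := fun β hf =>
    (contDiffAt_wirtinger (m := 1) (contDiffAt_ofReal hf) (by norm_num)).differentiableAt
      (by norm_num)
  ext α β
  have e : wirtinger Complex.I β (fun w => ((f w + k w : ℝ) : ℂ)) =ᶠ[𝓝 z]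
      fun w => wirtinger Complex.I β (fun w => (f w : ℂ)) w +
        wirtinger Complex.I β (fun w => (k w : ℂ)) w := by
    filter_upwards [hd hf, hd hk] with w h1 h2
    simp only [Complex.ofReal_add]
    exact wirtinger_add h1 h2
  rw [complexHessian_apply, wirtinger_congr e, wirtinger_add (hw β hf) (hw β hk)]
  simp [complexHessian_apply]

theorem complexHessian_const_mul (a : ℝ) (hf : ContDiffAt ℝ 2 f z) :
    complexHessian (fun w => a * f w) z = (a : ℂ) • complexHessian f z := by
  have := complexHessian_comp (p := fun x => a * x) (p' := fun _ => a) (p'' := 0) hf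
    (Eventually.of_forall fun x => by simpa using (hasDerivAt_id x).const_mul a)
    (hasDerivAt_const _ _)
  simpa using this

theorem continuousAt_complexHessian (hf : ContDiffAt ℝ 2 f z) : ContinuousAt (complexHessian f) z := by
  have : ∀ α β, ContinuousAt (fun w => complexHessian f w α β) z := fun α β => by
    simp only [complexHessian_apply]
    exact (contDiffAt_wirtinger (m := 0) (contDiffAt_wirtinger (m := 1) (contDiffAt_ofReal hf)
      (by norm_num)) (by norm_num)).continuousAt
  exact continuousAt_pi.2 fun α => continuousAt_pi.2 fun β => this α β

end

/-! ### Traces, determinants and inverses of positive definite matrices -/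

theorem exists_eq_conjTranspose_mul_self {A : Matrix (Fin n) (Fin n) ℂ} (hA : A.PosSemidef) :
    ∃ B : Matrix (Fin n) (Fin n) ℂ, A = B.conjTranspose * B := by
  open scoped MatrixOrder Matrix.Norms.L2Operator in
  obtain ⟨B, h⟩ := CStarAlgebra.nonneg_iff_eq_star_mul_self.mp hA.nonneg
  exact ⟨B, h⟩

/-- With `A = B* B` the trace equals that of `B X B*`, which is positive semidefinite. Every
comparison of forms below reaches Laplacians through this fact. -/
theorem trace_mul_re_nonneg {A X : Matrix (Fin n) (Fin n) ℂ} (hA : A.PosSemidef)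
    (hX : X.PosSemidef) : 0 ≤ (A * X).trace.re := by
  obtain ⟨B, rfl⟩ := exists_eq_conjTranspose_mul_self hA
  rw [Matrix.mul_assoc, Matrix.trace_mul_comm]
  have := (hX.mul_mul_conjTranspose_same B).trace_nonneg
  exact (Complex.le_def.1 this).1

theorem isUnit_det {A : Matrix (Fin n) (Fin n) ℂ} (hA : A.PosDef) : IsUnit A.det :=
  (Matrix.isUnit_iff_isUnit_det A).1 hA.isUnit

theorem det_re_pos {A : Matrix (Fin n) (Fin n) ℂ} (hA : A.PosDef) : 0 < A.det.re :=
  (Complex.lt_def.1 hA.det_pos).1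

theorem ofReal_det_re {A : Matrix (Fin n) (Fin n) ℂ} (hA : A.PosDef) : (A.det.re : ℂ) = A.det := by
  have := (Complex.lt_def.1 hA.det_pos).2
  exact Complex.ext rfl (by simpa using this)

/-- If `X ≤ k A` with `A` positive definite, then `tr (A⁻¹ X) ≤ k n`. -/
theorem trace_inv_mul_re_le {A X : Matrix (Fin n) (Fin n) ℂ} {k : ℝ} (hA : A.PosDef)
    (hX : ((k : ℂ) • A - X).PosSemidef) : (A⁻¹ * X).trace.re ≤ k * n := by
  have h := trace_mul_re_nonneg hA.inv.posSemidef hX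
  rw [Matrix.mul_sub, Matrix.trace_sub, Matrix.mul_smul, Matrix.nonsing_inv_mul _ (isUnit_det hA),
    Matrix.trace_smul, Matrix.trace_one] at h
  simp at h
  linarith

/-- The Cauchy–Schwarz inequality `(tr A⁻¹Y)² ≤ n tr (A⁻¹Y)²`, with `n + 1` in place of `n`. -/
theorem sq_trace_inv_mul_re_le {A Y : Matrix (Fin n) (Fin n) ℂ} (hA : A.PosDef)
    (hY : Y.IsHermitian) :
    (A⁻¹ * Y).trace.re ^ 2 / (n + 1) ≤ (A⁻¹ * Y * (A⁻¹ * Y)).trace.re := by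
  set τ := (A⁻¹ * Y).trace.re with hτ
  -- Nonnegativity of `tr (A⁻¹Z)²` for `Z = Y - cA` reads `tr (A⁻¹Y)² ≥ 2cτ - c²n`, and this `c`
  -- makes the right side at least `τ²/(n+1)`. The denominator `n + 1` avoids a separate case `n =
  -- 0`.
  set c : ℝ := τ / (n + 1) with hc
  have key : ∀ Z : Matrix (Fin n) (Fin n) ℂ, Z.IsHermitian →
      0 ≤ (A⁻¹ * Z * (A⁻¹ * Z)).trace.re := by
    intro Z hZ
    obtain ⟨B, hB⟩ := exists_eq_conjTranspose_mul_self hA.inv.posSemidef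
    -- With `A⁻¹ = B* B` the trace is the squared Frobenius norm of the Hermitian matrix `B Z B*`.
    have e : (A⁻¹ * Z * (A⁻¹ * Z)).trace =
        ((B * Z * B.conjTranspose) * (B * Z * B.conjTranspose).conjTranspose).trace := by
      rw [hB, Matrix.conjTranspose_mul, Matrix.conjTranspose_mul, hZ.eq,
        Matrix.conjTranspose_conjTranspose]
      simp only [Matrix.mul_assoc]
      rw [Matrix.trace_mul_comm]
      simp only [Matrix.mul_assoc]
    rw [e]
    exact (Complex.le_def.1 (Matrix.posSemidef_self_mul_conjTranspose _).trace_nonneg).1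
  have h := key (Y - (c : ℂ) • A) (hY.sub (hA.isHermitian.smul (by simp [IsSelfAdjoint])))
  have e : A⁻¹ * (Y - (c : ℂ) • A) = A⁻¹ * Y - (c : ℂ) • (1 : Matrix (Fin n) (Fin n) ℂ) := by
    rw [Matrix.mul_sub, Matrix.mul_smul, Matrix.nonsing_inv_mul _ (isUnit_det hA)]
  rw [e] at h
  simp only [Matrix.mul_sub, Matrix.sub_mul, Matrix.smul_mul, Matrix.mul_smul, Matrix.one_mul,
    Matrix.mul_one, Matrix.trace_sub, Matrix.trace_smul, Matrix.trace_one, Complex.sub_re,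
    smul_eq_mul, Complex.re_ofReal_mul, Complex.sub_re, Fintype.card_fin, Complex.natCast_re,
    ← hτ] at h
  have hn : (0 : ℝ) < n + 1 := by positivity
  have h2 : c * (n + 1) = τ := by rw [hc]; field_simp
  have h3 : τ ^ 2 / (n + 1) = c * τ := by rw [hc]; ring
  rw [h3]
  have h4 : c * τ = c ^ 2 * n + c ^ 2 := by rw [← h2]; ring
  nlinarith [sq_nonneg c]

/-- The derivative of the determinant, in terms of the adjugate. -/
theorem hasFDerivAt_det {V : Type*} [NormedAddCommGroup V] [NormedSpace ℝ V]
    {G : V → Matrix (Fin n) (Fin n) ℂ} {G' : Fin n → Fin n → V →L[ℝ] ℂ} {x : V}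
    (hG : ∀ i j, HasFDerivAt (fun y => G y i j) (G' i j) x) :
    HasFDerivAt (fun y => (G y).det) (∑ i, ∑ j, (G x).adjugate j i • G' i j) x := by
  let F : ContinuousMultilinearMap ℂ (fun _ : Fin n => Fin n → ℂ) ℂ :=
    { toMultilinearMap := Matrix.detRowAlternating.toMultilinearMap
      cont := Continuous.matrix_det (continuous_id (X := Matrix (Fin n) (Fin n) ℂ)) }
  have h1 : HasFDerivAt (fun y => (fun i j => G y i j : Fin n → Fin n → ℂ))
      (ContinuousLinearMap.pi fun i => ContinuousLinearMap.pi fun j => G' i j) x :=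
    hasFDerivAt_pi.2 fun i => hasFDerivAt_pi.2 fun j => hG i j
  have h2 := ((F.hasFDerivAt (x := fun i j => G x i j)).restrictScalars ℝ).comp x h1
  refine h2.congr_fderiv ?_
  ext v
  -- The derivative of a multilinear map replaces one row at a time; Cramer's rule expands the
  -- determinant along the replaced row.
  have h3 : ∀ (i : Fin n) (b : Fin n → ℂ), F (Function.update (fun i j => G x i j) i b) =
      ∑ j, (G x).adjugate j i * b j := by
    intro i b
    have : F (Function.update (fun i j => G x i j) i b) = ((G x).updateRow i b).det := rfl
    rw [this, ← Matrix.cramer_transpose_apply, Matrix.cramer_eq_adjugate_mulVec,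
      ← Matrix.adjugate_transpose]
    rfl
  simp [ContinuousMultilinearMap.linearDeriv_apply, h3, smul_apply]

section

variable {V : Type*} [NormedAddCommGroup V] [NormedSpace ℝ V] {G : V → Matrix (Fin n) (Fin n) ℂ}
  {s : Set V} {x : V} {k : ℕ∞ω}

theorem contDiffWithinAt_det (hG : ∀ i j, ContDiffWithinAt ℝ k (fun y => G y i j) s x) :
    ContDiffWithinAt ℝ k (fun y => (G y).det) s x := by
  simp only [Matrix.det_apply']
  exact ContDiffWithinAt.sum fun σ _ => contDiffWithinAt_const.mul
    (contDiffWithinAt_prod fun i _ => hG _ _)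

theorem contDiffWithinAt_adjugate (hG : ∀ i j, ContDiffWithinAt ℝ k (fun y => G y i j) s x)
    (i j : Fin n) : ContDiffWithinAt ℝ k (fun y => (G y).adjugate i j) s x := by
  simp only [Matrix.adjugate_apply]
  refine contDiffWithinAt_det fun a b => ?_
  by_cases h : a = j
  · subst h
    simpa using contDiffWithinAt_const
  · simpa [Matrix.updateRow_ne h] using hG a b

theorem contDiffWithinAt_inv (hG : ∀ i j, ContDiffWithinAt ℝ k (fun y => G y i j) s x)
    (hx : IsUnit (G x).det) (i j : Fin n) :
    ContDiffWithinAt ℝ k (fun y => (G y)⁻¹ i j) s x := by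
  simp only [Matrix.inv_def, Matrix.smul_apply, Ring.inverse_eq_inv', smul_eq_mul]
  exact ((contDiffWithinAt_det hG).inv hx.ne_zero).mul (contDiffWithinAt_adjugate hG i j)

end

/-- The inverse is differentiable as adjugate over determinant; differentiating `G⁻¹ G = 1` then
identifies its derivative as `-G⁻¹ G' G⁻¹`. -/
theorem hasDerivAt_trace_inv_mul {G H : ℝ → Matrix (Fin n) (Fin n) ℂ}
    {G' H' : Matrix (Fin n) (Fin n) ℂ} {t : ℝ} (hG : ∀ i j, HasDerivAt (fun s => G s i j) (G' i j) t)
    (hH : ∀ i j, HasDerivAt (fun s => H s i j) (H' i j) t) (ht : IsUnit (G t).det) :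
    HasDerivAt (fun s => ((G s)⁻¹ * H s).trace)
      (((G t)⁻¹ * H').trace - ((G t)⁻¹ * G' * ((G t)⁻¹ * H t)).trace) t := by
  have hGc : ContinuousAt (fun s => (G s).det) t :=
    Continuous.matrix_det continuous_id |>.continuousAt.comp
      (continuousAt_pi.2 fun i => continuousAt_pi.2 fun j => (hG i j).continuousAt)
  have hev : ∀ᶠ s in 𝓝 t, IsUnit (G s).det :=
    (hGc.eventually_ne ht.ne_zero).mono fun s hs => hs.isUnit
  have hdet : DifferentiableAt ℝ (fun s => (G s).det) t :=
    (hasFDerivAt_det fun i j => (hG i j).hasFDerivAt).differentiableAt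
  have hadj : ∀ i j, DifferentiableAt ℝ (fun s => (G s).adjugate i j) t := fun i j => by
    simp only [Matrix.adjugate_apply]
    refine (hasFDerivAt_det (G' := fun a b =>
      fderiv ℝ (fun s => (G s).updateRow j (Pi.single i 1) a b) t) fun a b => ?_).differentiableAt
    refine DifferentiableAt.hasFDerivAt ?_
    by_cases h : a = j
    · subst h
      simp
    · simpa [Matrix.updateRow_ne h] using (hG a b).differentiableAt
  have hinv : ∀ i j, DifferentiableAt ℝ (fun s => (G s)⁻¹ i j) t := fun i j => by
    simp only [Matrix.inv_def, Matrix.smul_apply, Ring.inverse_eq_inv', smul_eq_mul]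
    exact (hdet.inv ht.ne_zero).mul (hadj i j)
  obtain ⟨M', hM'⟩ : ∃ M' : Matrix (Fin n) (Fin n) ℂ, ∀ i j,
      HasDerivAt (fun s => (G s)⁻¹ i j) (M' i j) t :=
    ⟨Matrix.of fun i j => deriv (fun s => (G s)⁻¹ i j) t, fun i j => (hinv i j).hasDerivAt⟩
  have h1 : M' * G t + (G t)⁻¹ * G' = 0 := by
    ext i j
    have e1 : HasDerivAt (fun s => ((G s)⁻¹ * G s) i j) ((M' * G t + (G t)⁻¹ * G') i j) t := by
      simp only [Matrix.mul_apply, Matrix.add_apply, ← Finset.sum_add_distrib]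
      exact HasDerivAt.fun_sum fun a _ => (hM' i a).mul (hG a j)
    have e2 : HasDerivAt (fun s => ((G s)⁻¹ * G s) i j) 0 t := by
      refine (hasDerivAt_const t ((1 : Matrix (Fin n) (Fin n) ℂ) i j)).congr_of_eventuallyEq ?_
      filter_upwards [hev] with s hs
      rw [Matrix.nonsing_inv_mul _ hs]
    exact e1.unique e2
  have h2 : M' = -((G t)⁻¹ * G' * (G t)⁻¹) := by
    have := congrArg (fun X => X * (G t)⁻¹) h1
    simp only [Matrix.add_mul, Matrix.mul_assoc, Matrix.mul_nonsing_inv _ ht, Matrix.mul_one,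
      Matrix.zero_mul] at this
    rw [Matrix.mul_assoc]
    exact eq_neg_of_add_eq_zero_left this
  have h3 : ((G t)⁻¹ * H').trace - ((G t)⁻¹ * G' * ((G t)⁻¹ * H t)).trace =
      ∑ i, ∑ a, (M' i a * H t a i + (G t)⁻¹ i a * H' a i) := by
    have e3 : ∀ i, ∑ a, (M' i a * H t a i + (G t)⁻¹ i a * H' a i) =
        (M' * H t) i i + ((G t)⁻¹ * H') i i := fun i => by
      simp only [Matrix.mul_apply, Finset.sum_add_distrib]
    simp only [e3, Finset.sum_add_distrib]
    rw [h2, Matrix.neg_mul]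
    simp only [Matrix.trace, Matrix.diag_apply, Matrix.neg_apply, Finset.sum_neg_distrib,
      Matrix.mul_assoc]
    ring
  rw [h3]
  simp only [Matrix.trace, Matrix.diag_apply, Matrix.mul_apply]
  exact HasDerivAt.fun_sum fun i _ => HasDerivAt.fun_sum fun a _ => (hM' i a).mul (hH a i)

/-- Jacobi's formula for `log det` of a family of positive definite matrices. -/
theorem hasDerivAt_log_det {G : ℝ → Matrix (Fin n) (Fin n) ℂ}
    {G' : Matrix (Fin n) (Fin n) ℂ} {t : ℝ} (hG : ∀ i j, HasDerivAt (fun s => G s i j) (G' i j) t)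
    (ht : (G t).PosDef) :
    HasDerivAt (fun s => Real.log (G s).det.re) ((G t)⁻¹ * G').trace.re t := by
  have h1 := (hasFDerivAt_det fun i j => (hG i j).hasFDerivAt).hasDerivAt
  have h2 := (Complex.reCLM.hasFDerivAt.comp_hasDerivAt t h1).log (det_re_pos ht).ne'
  refine h2.congr_deriv ?_
  have e : (∑ i, ∑ j, (G t).adjugate j i • ContinuousLinearMap.toSpanSingleton ℝ (G' i j)) 1 =
      ((G t).det.re : ℂ) * ((G t)⁻¹ * G').trace := by
    rw [ofReal_det_re ht, ← smul_eq_mul, ← Matrix.trace_smul, ← Matrix.smul_mul]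
    have : (G t).det • (G t)⁻¹ = (G t).adjugate := by
      rw [Matrix.inv_def, smul_smul, Ring.mul_inverse_cancel _ (isUnit_det ht), one_smul]
    rw [this, Matrix.trace_mul_comm]
    simp only [Matrix.trace, Matrix.diag_apply, Matrix.mul_apply]
    simp [sum_apply, mul_comm]
  simp only [Complex.reCLM_apply, Function.comp_apply]
  rw [e, Complex.re_ofReal_mul]
  field_simp [(det_re_pos ht).ne']

/-- The adjugate of a matrix field with symmetric first derivatives is divergence free. -/
theorem sum_wirtinger_adjugate {G : (Fin n → ℂ) → Matrix (Fin n) (Fin n) ℂ} {z : Fin n → ℂ} {c : ℂ}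
    (hG : ∀ i j, ContDiffAt ℝ 1 (fun w => G w i j) z) (hz : IsUnit (G z).det)
    (hsym : ∀ α i j, wirtinger c α (fun w => G w i j) z = wirtinger c i (fun w => G w α j) z)
    (β : Fin n) : ∑ α, wirtinger c α (fun w => (G w).adjugate β α) z = 0 := by
  set M := (G z)⁻¹ with hM
  have hd : ∀ i j, DifferentiableAt ℝ (fun w => G w i j) z := fun i j =>
    (hG i j).differentiableAt (by norm_num)
  have hda : ∀ i j, DifferentiableAt ℝ (fun w => (G w).adjugate i j) z := fun i j =>
    (contDiffWithinAt_univ.1 (contDiffWithinAt_adjugate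
      (fun i j => contDiffWithinAt_univ.2 (hG i j)) i j)).differentiableAt (by norm_num)
  have hdd : DifferentiableAt ℝ (fun w => (G w).det) z :=
    (contDiffWithinAt_univ.1 (contDiffWithinAt_det
      (fun i j => contDiffWithinAt_univ.2 (hG i j)))).differentiableAt (by norm_num)
  have hadj : (G z).adjugate = (G z).det • M := by
    rw [hM, Matrix.inv_def, smul_smul, Ring.mul_inverse_cancel _ hz, one_smul]
  let P : Fin n → Matrix (Fin n) (Fin n) ℂ := fun α =>
    Matrix.of fun i j => wirtinger c α (fun w => G w i j) z
  let Q : Fin n → Matrix (Fin n) (Fin n) ℂ := fun α =>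
    Matrix.of fun i j => wirtinger c α (fun w => (G w).adjugate i j) z
  have hdet : ∀ α, wirtinger c α (fun w => (G w).det) z =
      (G z).det * ∑ i, ∑ j, M j i * P α i j := by
    intro α
    rw [wirtinger, (hasFDerivAt_det fun i j => (hd i j).hasFDerivAt).fderiv]
    simp only [map_sum, map_smul, hadj, Finset.mul_sum, Matrix.smul_apply, smul_eq_mul]
    exact Finset.sum_congr rfl fun i _ => Finset.sum_congr rfl fun j _ => by
      simp only [P, Matrix.of_apply, wirtinger]; ring
  -- This is the derivative of `adj(G) G = det(G) 1`; solved for `Q α`, it expresses the derivative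
  -- of the adjugate through `M = G⁻¹` and `P`.
  have hQ : ∀ α, Q α * G z + (G z).adjugate * P α =
      wirtinger c α (fun w => (G w).det) z • (1 : Matrix (Fin n) (Fin n) ℂ) := by
    intro α
    ext i j
    have e1 : wirtinger c α (fun w => ∑ a, (G w).adjugate i a * G w a j) z =
        ∑ a, ((G z).adjugate i a * P α a j + Q α i a * G z a j) := by
      rw [wirtinger_sum fun a _ => (hda i a).fun_mul (hd a j)]
      exact Finset.sum_congr rfl fun a _ => by
        rw [wirtinger_mul (hda i a) (hd a j)]; rfl
    have e2 : (fun w => ∑ a, (G w).adjugate i a * G w a j) =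
        fun w => (1 : Matrix (Fin n) (Fin n) ℂ) i j * (G w).det := by
      funext w
      rw [← Matrix.mul_apply, Matrix.adjugate_mul, Matrix.smul_apply, smul_eq_mul, mul_comm]
    rw [e2, wirtinger_const_mul _ hdd] at e1
    rw [Matrix.smul_apply, smul_eq_mul, mul_comm, e1, Matrix.add_apply, Matrix.mul_apply,
      Matrix.mul_apply, ← Finset.sum_add_distrib]
    exact Finset.sum_congr rfl fun a _ => add_comm _ _
  have hQ2 : ∀ α, Q α β α = (G z).det * (∑ i, ∑ j, M j i * P α i j * M β α) -
      (G z).det * ∑ i, ∑ j, M β i * P α i j * M j α := by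
    intro α
    have h1 : Q α = wirtinger c α (fun w => (G w).det) z • M - (G z).adjugate * P α * M := by
      have := congrArg (fun X => X * M) (hQ α)
      simp only [Matrix.add_mul, Matrix.mul_assoc, hM, Matrix.mul_nonsing_inv _ hz, Matrix.mul_one,
        Matrix.smul_mul, Matrix.one_mul] at this
      rw [Matrix.mul_assoc, hM]
      exact eq_sub_of_add_eq this
    rw [h1, hdet, hadj]
    simp only [Matrix.sub_apply, Matrix.smul_apply, smul_eq_mul, Matrix.mul_apply, Finset.sum_mul,
      Finset.mul_sum]
    congr 1
    · exact Finset.sum_congr rfl fun i _ => Finset.sum_congr rfl fun j _ => by ring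
    · rw [Finset.sum_comm]
      exact Finset.sum_congr rfl fun i _ => Finset.sum_congr rfl fun j _ => by ring
  change ∑ α, Q α β α = 0
  simp only [hQ2, Finset.sum_sub_distrib, ← Finset.mul_sum]
  rw [← mul_sub, sub_eq_zero.2, mul_zero]
  -- The two triple sums correspond under exchanging `α` and `i`, because `P α i j = P i α j` is the
  -- symmetry hypothesis (the Kähler condition in the application).
  conv_rhs => rw [Finset.sum_comm]
  refine Finset.sum_congr rfl fun α _ => Finset.sum_congr rfl fun i _ =>
    Finset.sum_congr rfl fun j _ => ?_
  have : P α i j = P i α j := hsym α i j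
  rw [this]; ring

theorem contDiffWithinAt_trace_inv_mul {V : Type*} [NormedAddCommGroup V] [NormedSpace ℝ V]
    {G H : V → Matrix (Fin n) (Fin n) ℂ} {s : Set V} {x : V} {k : ℕ∞ω}
    (hG : ∀ i j, ContDiffWithinAt ℝ k (fun y => G y i j) s x) (hx : IsUnit (G x).det)
    (hH : ∀ i j, ContDiffWithinAt ℝ k (fun y => H y i j) s x) :
    ContDiffWithinAt ℝ k (fun y => ((G y)⁻¹ * H y).trace.re) s x := by
  simp only [Matrix.trace, Matrix.diag_apply, Matrix.mul_apply]
  exact Complex.reCLM.contDiff.contDiffAt.comp_contDiffWithinAt x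
    (ContDiffWithinAt.sum fun i _ => ContDiffWithinAt.sum fun j _ =>
      (contDiffWithinAt_inv hG hx i j).mul (hH j i))

theorem contDiffAt_complexHessian {f : (Fin n → ℂ) → ℝ} {z : Fin n → ℂ} {m k : ℕ∞ω}
    (hf : ContDiffAt ℝ k f z) (hm : m + 1 + 1 ≤ k) (α β : Fin n) :
    ContDiffAt ℝ m (fun w => complexHessian f w α β) z := by
  simp only [complexHessian_apply]
  exact contDiffAt_wirtinger (contDiffAt_wirtinger (contDiffAt_ofReal hf) hm) le_rfl

/-! ### Integration by parts for fields vanishing off a compact subset -/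

section

variable {Ω K : Set (Fin n → ℂ)}

theorem integrableOn_of_eq_zero_off_compact {F : Type*} [NormedAddCommGroup F]
    {X : (Fin n → ℂ) → F} (hΩ : IsOpen Ω) (hK : IsCompact K) (hKΩ : K ⊆ Ω)
    (hX : ContinuousOn X Ω) (h0 : ∀ z ∈ Ω, z ∉ K → X z = 0) : IntegrableOn X Ω :=
  ((hX.mono hKΩ).integrableOn_compact hK).of_forall_sdiff_eq_zero hΩ.measurableSet
    fun z hz => h0 z hz.1 hz.2

theorem eventually_eq_zero_off_compact {F : Type*} [Zero F] {X : (Fin n → ℂ) → F} (hΩ : IsOpen Ω)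
    (hK : IsCompact K) (h0 : ∀ z ∈ Ω, z ∉ K → X z = 0) {z : Fin n → ℂ} (hz : z ∈ Ω) (hzK : z ∉ K) :
    X =ᶠ[𝓝 z] fun _ => 0 := by
  filter_upwards [hΩ.mem_nhds hz, hK.isClosed.isOpen_compl.mem_nhds hzK] with w h1 h2
    using h0 w h1 h2

/-- Extended by zero, `X` is `C¹` with compact support on the whole space, where directional
derivatives integrate to zero. No regularity of the boundary of `Ω` is involved. -/
theorem integral_wirtinger_eq_zero {X : (Fin n → ℂ) → ℂ} (hΩ : IsOpen Ω) (hK : IsCompact K)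
    (hKΩ : K ⊆ Ω) (hX : ∀ z ∈ Ω, ContDiffAt ℝ 1 X z) (h0 : ∀ z ∈ Ω, z ∉ K → X z = 0)
    (c : ℂ) (α : Fin n) :
    IntegrableOn (wirtinger c α X) Ω ∧ ∫ z in Ω, wirtinger c α X z = 0 := by
  have hcont : ContinuousOn (wirtinger c α X) Ω := fun z hz =>
    (contDiffAt_wirtinger (m := 0) (hX z hz) (by norm_num)).continuousAt.continuousWithinAt
  have hz0 : ∀ z ∈ Ω, z ∉ K → wirtinger c α X z = 0 := fun z hz hzK => by
    rw [wirtinger_congr (eventually_eq_zero_off_compact hΩ hK h0 hz hzK), wirtinger_const]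
  refine ⟨integrableOn_of_eq_zero_off_compact hΩ hK hKΩ hcont hz0, ?_⟩
  set Y := Ω.indicator X with hY
  have hYK : ∀ z, z ∉ K → Y =ᶠ[𝓝 z] fun _ => 0 := fun z hz => by
    filter_upwards [hK.isClosed.isOpen_compl.mem_nhds hz] with w hw
    by_cases h : w ∈ Ω
    · rw [hY, indicator_of_mem h, h0 w h hw]
    · rw [hY, indicator_of_notMem h]
  have hYΩ : ∀ z ∈ Ω, Y =ᶠ[𝓝 z] X := fun z hz => by
    filter_upwards [hΩ.mem_nhds hz] with w hw using indicator_of_mem hw X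
  have hYC : ContDiff ℝ 1 Y := contDiff_iff_contDiffAt.2 fun z => by
    by_cases h : z ∈ K
    · exact (hX z (hKΩ h)).congr_of_eventuallyEq (hYΩ z (hKΩ h))
    · exact contDiffAt_const.congr_of_eventuallyEq (hYK z h)
  have hYs : HasCompactSupport Y :=
    HasCompactSupport.intro hK fun z hz => (hYK z hz).self_of_nhds
  have hint : ∀ v : Fin n → ℂ, Integrable (fun z => fderiv ℝ Y z v) := fun v =>
    ((hYC.continuous_fderiv (by norm_num)).clm_apply continuous_const).integrable_of_hasCompactSupport
      ((hYs.fderiv (𝕜 := ℝ)).comp_left (g := fun L : (Fin n → ℂ) →L[ℝ] ℂ => L v) (by simp))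
  have hzero : ∀ v : Fin n → ℂ, ∫ z, fderiv ℝ Y z v = 0 := fun v => by
    have := integral_mul_fderiv_eq_neg_fderiv_mul_of_integrable (μ := volume) (v := v) (f := Y)
      (g := fun _ => (1 : ℂ)) (by simpa using hint v) (by simp)
      (by simpa using hYC.continuous.integrable_of_hasCompactSupport hYs)
      (fun x _ => (hYC.differentiable (by norm_num)) x) (fun x _ => differentiableAt_const _)
    simpa using this
  have e1 : ∫ z in Ω, wirtinger c α X z = ∫ z in Ω, wirtinger c α Y z :=
    setIntegral_congr_fun hΩ.measurableSet fun z hz => (wirtinger_congr (hYΩ z hz)).symm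
  have e2 : ∫ z in Ω, wirtinger c α Y z = ∫ z, wirtinger c α Y z :=
    setIntegral_eq_integral_of_forall_compl_eq_zero fun z hz => by
      rw [wirtinger_congr (hYK z fun h => hz (hKΩ h)), wirtinger_const]
  rw [e1, e2]
  change ∫ z, (1 / 2 : ℂ) * (fderiv ℝ Y z (Pi.single α 1) +
    c * fderiv ℝ Y z (Pi.single α Complex.I)) = 0
  rw [integral_const_mul, integral_add (hint _) ((hint _).const_mul c), integral_const_mul, hzero,
    hzero]
  simp

/-- The Laplacian of a Kähler metric is symmetric with respect to its volume form. -/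
theorem integral_mul_laplacian_symm {g h v : (Fin n → ℂ) → ℝ} (hΩ : IsOpen Ω) (hK : IsCompact K)
    (hKΩ : K ⊆ Ω) (hg : ∀ z ∈ Ω, ContDiffAt ℝ 3 g z) (hpos : ∀ z ∈ Ω, (complexHessian g z).PosDef)
    (hh : ∀ z ∈ Ω, ContDiffAt ℝ 2 h z) (hv : ∀ z ∈ Ω, ContDiffAt ℝ 2 v z)
    (h0 : ∀ z ∈ Ω, z ∉ K → h z = 0) :
    ∫ z in Ω, h z * laplacian (complexHessian g) v z * (complexHessian g z).det.re =
      ∫ z in Ω, v z * laplacian (complexHessian g) h z * (complexHessian g z).det.re := by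
  have hG : ∀ z ∈ Ω, ∀ i j, ContDiffAt ℝ 1 (fun w => complexHessian g w i j) z :=
    fun z hz i j => contDiffAt_complexHessian (hg z hz) (by norm_num) i j
  have hA : ∀ z ∈ Ω, ∀ i j, ContDiffAt ℝ 1 (fun w => (complexHessian g w).adjugate i j) z :=
    fun z hz i j => contDiffWithinAt_univ.1
      (contDiffWithinAt_adjugate (fun i j => contDiffWithinAt_univ.2 (hG z hz i j)) i j)
  have hw : ∀ {f : (Fin n → ℂ) → ℝ} (c : ℂ) (β : Fin n) {z}, ContDiffAt ℝ 2 f z →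
      ContDiffAt ℝ 1 (wirtinger c β (fun w => (f w : ℂ))) z := fun c β z hf =>
    contDiffAt_wirtinger (m := 1) (contDiffAt_ofReal hf) (by norm_num)
  have hlap : ∀ {f : (Fin n → ℂ) → ℝ}, (∀ z ∈ Ω, ContDiffAt ℝ 2 f z) →
      ContinuousOn (laplacian (complexHessian g) f) Ω := fun hf z hz =>
    (contDiffWithinAt_trace_inv_mul (k := 0)
      (fun i j => ((hG z hz i j).of_le (by norm_num)).contDiffWithinAt) (isUnit_det (hpos z hz))
      (fun i j => (contDiffAt_complexHessian (hf z hz) (by norm_num) i j).contDiffWithinAt)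
      ).continuousWithinAt
  have hdet : ContinuousOn (fun z => (complexHessian g z).det.re) Ω := fun z hz =>
    (Complex.reCLM.contDiff.contDiffAt.comp_contDiffWithinAt z (contDiffWithinAt_det (k := 0)
      (fun i j => ((hG z hz i j).of_le (by norm_num)).contDiffWithinAt))).continuousWithinAt
  have hhK : ∀ z ∈ Ω, z ∉ K → (fun w => (h w : ℂ)) =ᶠ[𝓝 z] fun _ => 0 := fun z hz hzK =>
    (eventually_eq_zero_off_compact hΩ hK h0 hz hzK).mono fun w hw => by simp [hw]
  have hi1 : IntegrableOn
      (fun z => h z * laplacian (complexHessian g) v z * (complexHessian g z).det.re) Ω :=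
    integrableOn_of_eq_zero_off_compact hΩ hK hKΩ
      (((continuousOn_of_forall_continuousAt fun z hz => (hh z hz).continuousAt).mul
        (hlap hv)).mul hdet) (fun z hz hzK => by rw [h0 z hz hzK]; ring)
  have hi2 : IntegrableOn
      (fun z => v z * laplacian (complexHessian g) h z * (complexHessian g z).det.re) Ω :=
    integrableOn_of_eq_zero_off_compact hΩ hK hKΩ
      (((continuousOn_of_forall_continuousAt fun z hz => (hv z hz).continuousAt).mul
        (hlap hh)).mul hdet) (fun z hz hzK => by
          have : complexHessian h z = 0 := by
            ext α β
            rw [complexHessian_apply, wirtinger_congr ((wirtinger_congr_nhds (hhK z hz hzK)).trans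
              (Eventually.of_forall fun w => wirtinger_const 0)), wirtinger_const]
            rfl
          rw [laplacian, this]
          simp)
  -- As `det(G) G⁻¹ = adj(G)`, the difference of the two integrands is the divergence of `X` minus
  -- that of `Y`: the mixed terms in `∂h` and `∂̄v` cancel, and the terms that differentiate the
  -- adjugate sum to zero.
  let X : Fin n → (Fin n → ℂ) → ℂ := fun α w => ∑ β, (complexHessian g w).adjugate β α *
    ((h w : ℂ) * wirtinger Complex.I β (fun w => (v w : ℂ)) w)
  let Y : Fin n → (Fin n → ℂ) → ℂ := fun β w => ∑ α, (complexHessian g w).adjugate β α *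
    ((v w : ℂ) * wirtinger (-Complex.I) α (fun w => (h w : ℂ)) w)
  have hX : ∀ α, ∀ z ∈ Ω, ContDiffAt ℝ 1 (X α) z := fun α z hz =>
    ContDiffAt.sum fun β _ => (hA z hz β α).mul
      ((contDiffAt_ofReal ((hh z hz).of_le (by norm_num))).mul (hw _ _ (hv z hz)))
  have hY : ∀ β, ∀ z ∈ Ω, ContDiffAt ℝ 1 (Y β) z := fun β z hz =>
    ContDiffAt.sum fun α _ => (hA z hz β α).mul
      ((contDiffAt_ofReal ((hv z hz).of_le (by norm_num))).mul (hw _ _ (hh z hz)))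
  have hX0 : ∀ α, ∀ z ∈ Ω, z ∉ K → X α z = 0 := fun α z hz hzK =>
    Finset.sum_eq_zero fun β _ => by rw [h0 z hz hzK]; simp
  have hY0 : ∀ β, ∀ z ∈ Ω, z ∉ K → Y β z = 0 := fun β z hz hzK =>
    Finset.sum_eq_zero fun α _ => by rw [wirtinger_congr (hhK z hz hzK), wirtinger_const]; simp
  have iX := fun α => integral_wirtinger_eq_zero hΩ hK hKΩ (hX α) (hX0 α) (-Complex.I) α
  have iY := fun β => integral_wirtinger_eq_zero hΩ hK hKΩ (hY β) (hY0 β) Complex.I β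
  have key : ∀ z ∈ Ω, ((h z * laplacian (complexHessian g) v z * (complexHessian g z).det.re -
      v z * laplacian (complexHessian g) h z * (complexHessian g z).det.re : ℝ)) =
      (∑ α, wirtinger (-Complex.I) α (X α) z - ∑ β, wirtinger Complex.I β (Y β) z).re := by
    intro z hz
    have hadj : (complexHessian g z).adjugate =
        ((complexHessian g z).det.re : ℂ) • (complexHessian g z)⁻¹ := by
      rw [ofReal_det_re (hpos z hz), Matrix.inv_def, smul_smul,
        Ring.mul_inverse_cancel _ (isUnit_det (hpos z hz)), one_smul]
    have hsum : ∀ f : (Fin n → ℂ) → ℝ, laplacian (complexHessian g) f z *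
        (complexHessian g z).det.re =
          (∑ α, ∑ β, (complexHessian g z).adjugate β α * complexHessian f z α β).re := by
      intro f
      have : ∑ α, ∑ β, (complexHessian g z).adjugate β α * complexHessian f z α β =
          ((complexHessian g z).adjugate * complexHessian f z).trace := by
        simp only [Matrix.trace, Matrix.diag_apply, Matrix.mul_apply]
        rw [Finset.sum_comm]
      rw [this, hadj, Matrix.smul_mul, Matrix.trace_smul, smul_eq_mul, Complex.re_ofReal_mul,
        laplacian, mul_comm]
    have dA := fun i j => (hA z hz i j).differentiableAt (by norm_num)
    have dh : DifferentiableAt ℝ (fun w => (h w : ℂ)) z :=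
      (contDiffAt_ofReal (hh z hz)).differentiableAt (by norm_num)
    have dv : DifferentiableAt ℝ (fun w => (v w : ℂ)) z :=
      (contDiffAt_ofReal (hv z hz)).differentiableAt (by norm_num)
    have dwv := fun β => (hw Complex.I β (hv z hz)).differentiableAt (by norm_num)
    have dwh := fun α => (hw (-Complex.I) α (hh z hz)).differentiableAt (by norm_num)
    have eX : ∀ α, wirtinger (-Complex.I) α (X α) z = ∑ β, ((complexHessian g z).adjugate β α *
        (h z * complexHessian v z α β + wirtinger (-Complex.I) α (fun w => (h w : ℂ)) z *
          wirtinger Complex.I β (fun w => (v w : ℂ)) z) +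
        wirtinger (-Complex.I) α (fun w => (complexHessian g w).adjugate β α) z *
          (h z * wirtinger Complex.I β (fun w => (v w : ℂ)) z)) := by
      intro α
      rw [wirtinger_sum fun β _ => (dA β α).fun_mul (dh.fun_mul (dwv β))]
      refine Finset.sum_congr rfl fun β _ => ?_
      rw [wirtinger_mul (dA β α) (dh.fun_mul (dwv β)), wirtinger_mul dh (dwv β),
        complexHessian_apply]
    have eY : ∀ β, wirtinger Complex.I β (Y β) z = ∑ α, ((complexHessian g z).adjugate β α *
        (v z * complexHessian h z α β + wirtinger Complex.I β (fun w => (v w : ℂ)) z *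
          wirtinger (-Complex.I) α (fun w => (h w : ℂ)) z) +
        wirtinger Complex.I β (fun w => (complexHessian g w).adjugate β α) z *
          (v z * wirtinger (-Complex.I) α (fun w => (h w : ℂ)) z)) := by
      intro β
      rw [wirtinger_sum fun α _ => (dA β α).fun_mul (dv.fun_mul (dwh α))]
      refine Finset.sum_congr rfl fun α _ => ?_
      rw [wirtinger_mul (dA β α) (dv.fun_mul (dwh α)), wirtinger_mul dv (dwh α),
        complexHessian_apply, wirtinger_comm (contDiffAt_ofReal (hh z hz))]
    have hg2 : ∀ c β, ContDiffAt ℝ 2 (wirtinger c β (fun w => (g w : ℂ))) z := fun c β =>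
      contDiffAt_wirtinger (contDiffAt_ofReal (hg z hz)) (by norm_num)
    have hgc : ∀ i, ∀ᶠ w in 𝓝 z, ∀ j, complexHessian g w i j =
        wirtinger Complex.I j (wirtinger (-Complex.I) i (fun w => (g w : ℂ))) w := fun i => by
      filter_upwards [hΩ.mem_nhds hz] with w hw j
      rw [complexHessian_apply,
        wirtinger_comm (contDiffAt_ofReal ((hg w hw).of_le (by norm_num)))]
    have div1 : ∀ β, ∑ α, wirtinger (-Complex.I) α
        (fun w => (complexHessian g w).adjugate β α) z = 0 :=
      sum_wirtinger_adjugate (hG z hz) (isUnit_det (hpos z hz)) fun α i j => by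
        simp only [complexHessian_apply]
        exact wirtinger_comm (hg2 _ _)
    -- For the `∂̄` divergence the roles of the indices are exchanged, so the lemma is applied to
    -- the transposed Hessian.
    have div2 : ∀ α, ∑ β, wirtinger Complex.I β
        (fun w => (complexHessian g w).adjugate β α) z = 0 := by
      have := sum_wirtinger_adjugate (G := fun w => (complexHessian g w).transpose) (z := z)
        (c := Complex.I) (fun i j => hG z hz j i)
        (by rw [Matrix.det_transpose]; exact isUnit_det (hpos z hz)) (fun α i j => by
          simp only [Matrix.transpose_apply]
          rw [wirtinger_congr ((hgc j).mono fun w hw => hw i),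
            wirtinger_congr ((hgc j).mono fun w hw => hw α)]
          exact wirtinger_comm (hg2 _ _))
      simpa only [← Matrix.adjugate_transpose, Matrix.transpose_apply] using this
    rw [mul_assoc, mul_assoc, hsum, hsum, ← Complex.re_ofReal_mul, ← Complex.re_ofReal_mul,
      ← Complex.sub_re]
    congr 1
    simp only [eX, eY]
    simp only [Finset.sum_add_distrib, mul_add]
    have z1 : ∑ α, ∑ β, wirtinger (-Complex.I) α (fun w => (complexHessian g w).adjugate β α) z *
          (h z * wirtinger Complex.I β (fun w => (v w : ℂ)) z) = 0 := by
      rw [Finset.sum_comm]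
      exact Finset.sum_eq_zero fun β _ => by rw [← Finset.sum_mul, div1, zero_mul]
    have z2 : ∑ β, ∑ α, wirtinger Complex.I β (fun w => (complexHessian g w).adjugate β α) z *
          (v z * wirtinger (-Complex.I) α (fun w => (h w : ℂ)) z) = 0 := by
      rw [Finset.sum_comm]
      exact Finset.sum_eq_zero fun α _ => by rw [← Finset.sum_mul, div2, zero_mul]
    rw [z1, z2, Finset.sum_comm (f := fun β α => (complexHessian g z).adjugate β α *
        (v z * complexHessian h z α β)), Finset.sum_comm (f := fun β α =>
        (complexHessian g z).adjugate β α * (wirtinger Complex.I β (fun w => (v w : ℂ)) z *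
          wirtinger (-Complex.I) α (fun w => (h w : ℂ)) z))]
    have e1 : ∀ (a : ℂ) (f : (Fin n → ℂ) → ℝ), a * ∑ α, ∑ β, (complexHessian g z).adjugate β α *
        complexHessian f z α β = ∑ α, ∑ β, (complexHessian g z).adjugate β α *
          (a * complexHessian f z α β) := fun a f => by
      simp only [Finset.mul_sum]
      exact Finset.sum_congr rfl fun _ _ => Finset.sum_congr rfl fun _ _ => by ring
    rw [e1, e1]
    have e2 : ∑ α, ∑ β, (complexHessian g z).adjugate β α *
        (wirtinger Complex.I β (fun w => (v w : ℂ)) z *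
          wirtinger (-Complex.I) α (fun w => (h w : ℂ)) z) =
        ∑ α, ∑ β, (complexHessian g z).adjugate β α *
          (wirtinger (-Complex.I) α (fun w => (h w : ℂ)) z *
          wirtinger Complex.I β (fun w => (v w : ℂ)) z) :=
      Finset.sum_congr rfl fun _ _ => Finset.sum_congr rfl fun _ _ => by ring
    rw [e2]
    ring
  rw [← sub_eq_zero, ← integral_sub hi1 hi2, setIntegral_congr_fun hΩ.measurableSet key]
  have iXs : IntegrableOn (fun z => ∑ α, wirtinger (-Complex.I) α (X α) z) Ω :=
    integrable_finsetSum _ fun α _ => (iX α).1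
  have iYs : IntegrableOn (fun z => ∑ β, wirtinger Complex.I β (Y β) z) Ω :=
    integrable_finsetSum _ fun β _ => (iY β).1
  have := integral_re (𝕜 := ℂ) (iXs.sub iYs)
  refine this.trans ?_
  simp only [Pi.sub_apply]
  rw [integral_sub iXs iYs, integral_finsetSum _ fun α _ => (iX α).1,
    integral_finsetSum _ fun β _ => (iY β).1]
  simp [(iX _).2, (iY _).2]

end

/-! ### The defining function and the reference metric -/

theorem natCast_le_infty (m : ℕ) : (m : ℕ∞ω) ≤ ∞ := by
  exact_mod_cast (le_top : ((m : ℕ) : ℕ∞) ≤ ⊤)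

theorem two_le_infty : (2 : ℕ∞ω) ≤ ∞ := natCast_le_infty 2

/-- For real `f` the real and imaginary parts of `∂f/∂z^α` are, up to factors `±1/2`, the partial
derivatives in `x^α` and `y^α`. Thus `dr ≠ 0` on the boundary yields `∂r ≠ 0`. -/
theorem fderiv_eq_zero_of_complexGradient_eq_zero {f : (Fin n → ℂ) → ℝ} {z : Fin n → ℂ}
    (hf : DifferentiableAt ℝ f z) (h : complexGradient f z = 0) : fderiv ℝ f z = 0 := by
  have h1 : HasFDerivAt (fun w => (f w : ℂ)) (Complex.ofRealCLM.comp (fderiv ℝ f z)) z :=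
    Complex.ofRealCLM.hasFDerivAt.comp z hf.hasFDerivAt
  have h2 : ∀ α : Fin n, fderiv ℝ f z (Pi.single α 1) = 0 ∧
      fderiv ℝ f z (Pi.single α Complex.I) = 0 := by
    intro α
    have h3 := congrFun h α
    simp only [complexGradient, wirtinger, h1.fderiv, wirtingerForm, LinearMap.coe_mk,
      AddHom.coe_mk, ContinuousLinearMap.comp_apply, Complex.ofRealCLM_apply, Pi.zero_apply] at h3
    have hre := congrArg Complex.re h3
    have him := congrArg Complex.im h3
    simp at hre him
    exact ⟨hre, him⟩
  ext v
  have hv : v = ∑ α, ((v α).re • (Pi.single α 1 : Fin n → ℂ) +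
      (v α).im • (Pi.single α Complex.I : Fin n → ℂ)) := by
    ext β
    rw [Finset.sum_apply, Finset.sum_eq_single β]
    · simp
    · intro γ _ hγ
      simp [Pi.single_eq_of_ne (Ne.symm hγ)]
    · simp
  rw [hv, map_sum]
  refine Finset.sum_eq_zero fun α _ => ?_
  rw [map_add, map_smul, map_smul, (h2 α).1, (h2 α).2]
  simp

/-- The quotient of the two quadratic forms is continuous on the compact product of `S` with the
unit sphere, hence bounded above; homogeneity extends the bound to all vectors. -/
theorem exists_smul_sub_posSemidef {E : Type*} [TopologicalSpace E] {S : Set E} (hS : IsCompact S)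
    {A X : E → Matrix (Fin n) (Fin n) ℂ} (hA : ContinuousOn A S) (hX : ContinuousOn X S)
    (hpos : ∀ z ∈ S, (A z).PosDef) (hherm : ∀ z ∈ S, (X z).IsHermitian) :
    ∃ k : ℝ, 0 ≤ k ∧ ∀ z ∈ S, ((k : ℂ) • A z - X z).PosSemidef := by
  let Q : Matrix (Fin n) (Fin n) ℂ → (Fin n → ℂ) → ℝ := fun B v => (star v ⬝ᵥ B.mulVec v).re
  have hQc : ∀ {B : E → Matrix (Fin n) (Fin n) ℂ}, ContinuousOn B S →
      ContinuousOn (fun p : E × (Fin n → ℂ) => Q (B p.1) p.2)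
        (S ×ˢ Metric.sphere (0 : Fin n → ℂ) 1) := by
    intro B hB
    have h1 : ContinuousOn (fun p : E × (Fin n → ℂ) => B p.1)
        (S ×ˢ Metric.sphere (0 : Fin n → ℂ) 1) := hB.comp continuousOn_fst fun p hp => hp.1
    have h2 : Continuous (fun q : Matrix (Fin n) (Fin n) ℂ × (Fin n → ℂ) => Q q.1 q.2) := by
      simp only [Q]
      refine Complex.continuous_re.comp ?_
      exact Continuous.dotProduct (continuous_star.comp continuous_snd)
        (Continuous.matrix_mulVec continuous_fst continuous_snd)
    exact h2.comp_continuousOn (f := fun p : E × (Fin n → ℂ) => (B p.1, p.2))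
      (h1.prodMk continuousOn_snd)
  have hQpos : ∀ z ∈ S, ∀ v ≠ 0, 0 < Q (A z) v := fun z hz v hv =>
    (Complex.lt_def.1 ((hpos z hz).dotProduct_mulVec_pos hv)).1
  have hne : ∀ p ∈ S ×ˢ Metric.sphere (0 : Fin n → ℂ) 1, Q (A p.1) p.2 ≠ 0 := fun p hp =>
    (hQpos p.1 hp.1 p.2 (by rintro h; simpa [h] using hp.2)).ne'
  obtain ⟨k, hk⟩ := ((hS.prod (isCompact_sphere (0 : Fin n → ℂ) 1)).image_of_continuousOn
    ((hQc hX).div (hQc hA) hne)).bddAbove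
  refine ⟨max k 0, le_max_right _ _, fun z hz => ?_⟩
  refine Matrix.PosSemidef.of_dotProduct_mulVec_nonneg
    (((hpos z hz).isHermitian.smul (by simp [IsSelfAdjoint])).sub (hherm z hz)) fun x => ?_
  have hre : ∀ B : Matrix (Fin n) (Fin n) ℂ, B.IsHermitian → star x ⬝ᵥ B.mulVec x = (Q B x : ℂ) :=
    fun B hB => Complex.ext (by simp [Q]) (by
      have := hB.im_star_dotProduct_mulVec_self x
      simpa [Q] using this)
  rw [Matrix.sub_mulVec, dotProduct_sub, Matrix.smul_mulVec, dotProduct_smul,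
    hre _ (hpos z hz).isHermitian, hre _ (hherm z hz), smul_eq_mul, ← Complex.ofReal_mul,
    ← Complex.ofReal_sub, Complex.zero_le_real, sub_nonneg]
  rcases eq_or_ne x 0 with rfl | hx
  · simp [Q]
  set y : Fin n → ℂ := ((‖x‖⁻¹ : ℝ) : ℂ) • x with hy
  have hxn : 0 < ‖x‖ := norm_pos_iff.2 hx
  have hyn : y ∈ Metric.sphere (0 : Fin n → ℂ) 1 := by
    rw [mem_sphere_zero_iff_norm, hy, norm_smul]
    simp [hxn.ne']
  have hsc : ∀ B : Matrix (Fin n) (Fin n) ℂ, Q B y = ‖x‖⁻¹ ^ 2 * Q B x := fun B => by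
    simp only [Q, hy, star_smul, Matrix.mulVec_smul, smul_dotProduct, dotProduct_smul, smul_eq_mul]
    rw [show star ((‖x‖⁻¹ : ℝ) : ℂ) = ((‖x‖⁻¹ : ℝ) : ℂ) from Complex.conj_ofReal _,
      Complex.re_ofReal_mul, Complex.re_ofReal_mul]
    ring
  have h1 : Q (X z) y / Q (A z) y ≤ k := hk ⟨(z, y), ⟨hz, hyn⟩, rfl⟩
  rw [hsc, hsc, mul_div_mul_left _ _ (by positivity), div_le_iff₀ (hQpos z hz x hx)] at h1
  exact h1.trans (mul_le_mul_of_nonneg_right (le_max_left _ _) (hQpos z hz x hx).le)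


namespace IsStrictlyPshDefiningFunction

variable {Ω : Set (Fin n → ℂ)} {r : (Fin n → ℂ) → ℝ} {z : Fin n → ℂ}

theorem isCompact_closure (hr : IsStrictlyPshDefiningFunction Ω r) : IsCompact (closure Ω) :=
  hr.isBounded.isCompact_closure

theorem contDiffAt (hr : IsStrictlyPshDefiningFunction Ω r) (hz : z ∈ closure Ω) :
    ContDiffAt ℝ ∞ r z := by
  obtain ⟨U, hU, hUΩ, hrU, -⟩ := hr.exists_nhd
  exact hrU.contDiffAt (hU.mem_nhds (hUΩ hz))

theorem neg (hr : IsStrictlyPshDefiningFunction Ω r) (hz : z ∈ Ω) : r z < 0 := by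
  obtain ⟨U, -, -, -, h⟩ := hr.exists_nhd
  rw [h] at hz
  exact hz.2

theorem mem_of_neg (hr : IsStrictlyPshDefiningFunction Ω r) (hz : z ∈ closure Ω) (h : r z < 0) :
    z ∈ Ω := by
  obtain ⟨U, -, hU, -, e⟩ := hr.exists_nhd
  rw [e]
  exact ⟨hU hz, h⟩

theorem continuousOn_closure (hr : IsStrictlyPshDefiningFunction Ω r) :
    ContinuousOn r (closure Ω) :=
  continuousOn_of_forall_continuousAt fun _ hz => (hr.contDiffAt hz).continuousAt

theorem nonpos (hr : IsStrictlyPshDefiningFunction Ω r) (hz : z ∈ closure Ω) : r z ≤ 0 :=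
  closure_minimal (s := r '' Ω) (t := Iic 0) (by rintro _ ⟨w, hw, rfl⟩; exact (hr.neg hw).le)
    isClosed_Iic (hr.continuousOn_closure.image_closure ⟨z, hz, rfl⟩)

theorem fderiv_ne_zero_of_eq_zero (hr : IsStrictlyPshDefiningFunction Ω r) (hz : z ∈ closure Ω)
    (h : r z = 0) : fderiv ℝ r z ≠ 0 :=
  hr.fderiv_ne_zero z ⟨hz, fun hi => (hr.neg (interior_subset hi)).ne h⟩

theorem contDiffAt_refPotential (hr : IsStrictlyPshDefiningFunction Ω r) (hz : z ∈ Ω) :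
    ContDiffAt ℝ ∞ (refPotential r) z :=
  (((hr.contDiffAt (subset_closure hz)).neg).log (neg_pos.2 (hr.neg hz)).ne').neg

theorem exp_neg_refPotential (hr : IsStrictlyPshDefiningFunction Ω r) (hz : z ∈ Ω) :
    Real.exp (-refPotential r z) = -r z := by
  rw [refPotential, neg_neg, Real.exp_log (neg_pos.2 (hr.neg hz))]

/-- The condition `φ ≤ R` means `r ≤ -e^{-R}`, which is closed in the compact closure and stays away
from the boundary. So `φ` exhausts `Ω`, and maxima and cutoffs can be placed in these sets. -/
theorem isCompact_sublevel (hr : IsStrictlyPshDefiningFunction Ω r) (R : ℝ) :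
    IsCompact {z ∈ Ω | refPotential r z ≤ R} := by
  have e : {z ∈ Ω | refPotential r z ≤ R} = closure Ω ∩ r ⁻¹' Iic (-Real.exp (-R)) := by
    ext z
    constructor
    · rintro ⟨hz, h⟩
      refine ⟨subset_closure hz, ?_⟩
      have := Real.exp_le_exp.2 (neg_le_neg h)
      rw [hr.exp_neg_refPotential hz] at this
      simp only [mem_preimage, mem_Iic]
      linarith
    · rintro ⟨hz, h⟩
      simp only [mem_preimage, mem_Iic] at h
      have hz' := hr.mem_of_neg hz (by linarith [Real.exp_pos (-R)])
      refine ⟨hz', ?_⟩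
      have : Real.exp (-R) ≤ Real.exp (-refPotential r z) := by
        rw [hr.exp_neg_refPotential hz']; linarith
      linarith [Real.exp_le_exp.1 this]
  rw [e]
  exact hr.isCompact_closure.of_isClosed_subset
    (hr.continuousOn_closure.preimage_isClosed_of_isClosed isClosed_closure isClosed_Iic)
    inter_subset_left

theorem hasDerivAt_neg_log_neg {x : ℝ} (hx : x < 0) :
    HasDerivAt (fun x : ℝ => -Real.log (-x)) ((-x)⁻¹) x := by
  refine ((hasDerivAt_neg x).log (by linarith)).neg.congr_deriv ?_
  rw [inv_eq_one_div]; ring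

theorem refMetric_eq (hr : IsStrictlyPshDefiningFunction Ω r) (hz : z ∈ Ω) :
    refMetric r z = (((-r z)⁻¹ : ℝ) : ℂ) • complexHessian r z +
      (((-r z)⁻¹ ^ 2 : ℝ) : ℂ) • Matrix.vecMulVec (complexGradient r z)
        (star (complexGradient r z)) := by
  have hneg := hr.neg hz
  refine complexHessian_comp (p := fun x => -Real.log (-x)) (p' := fun x => (-x)⁻¹)
    ((hr.contDiffAt (subset_closure hz)).of_le two_le_infty)
    ((eventually_lt_nhds hneg).mono fun x hx => hasDerivAt_neg_log_neg hx) ?_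
  refine ((hasDerivAt_neg (r z)).inv (by linarith)).congr_deriv ?_
  field_simp

theorem complexGradient_refPotential (hr : IsStrictlyPshDefiningFunction Ω r) (hz : z ∈ Ω) :
    complexGradient (refPotential r) z = (((-r z)⁻¹ : ℝ) : ℂ) • complexGradient r z := by
  funext α
  exact wirtinger_comp (p := fun x => -Real.log (-x)) (hasDerivAt_neg_log_neg (hr.neg hz))
    ((hr.contDiffAt (subset_closure hz)).differentiableAt (by simp))

theorem refMetric_sub_posSemidef (hr : IsStrictlyPshDefiningFunction Ω r) (hz : z ∈ Ω) :
    (refMetric r z - (((-r z)⁻¹ : ℝ) : ℂ) • complexHessian r z).PosSemidef := by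
  rw [hr.refMetric_eq hz, add_sub_cancel_left]
  exact (Matrix.posSemidef_vecMulVec_self_star _).smul (by
    rw [Complex.zero_le_real]; positivity)

/-- `∂φ ∧ ∂̄φ ≤ ∂∂̄φ` for the potential `φ = -log(-r)`. -/
theorem refMetric_sub_gradient_posSemidef (hr : IsStrictlyPshDefiningFunction Ω r) (hz : z ∈ Ω) :
    (refMetric r z - Matrix.vecMulVec (complexGradient (refPotential r) z)
      (star (complexGradient (refPotential r) z))).PosSemidef := by
  have e : Matrix.vecMulVec (complexGradient (refPotential r) z)
      (star (complexGradient (refPotential r) z)) = (((-r z)⁻¹ ^ 2 : ℝ) : ℂ) •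
        Matrix.vecMulVec (complexGradient r z) (star (complexGradient r z)) := by
    rw [hr.complexGradient_refPotential hz, star_smul, Matrix.smul_vecMulVec,
      Matrix.vecMulVec_smul, smul_smul, show star (((-r z)⁻¹ : ℝ) : ℂ) = (((-r z)⁻¹ : ℝ) : ℂ) from
        Complex.conj_ofReal _]
    rw [← Complex.ofReal_mul, sq]
  rw [e, hr.refMetric_eq hz, add_sub_cancel_right]
  exact (hr.posDef z (subset_closure hz)).posSemidef.smul (by
    rw [Complex.zero_le_real]; have := hr.neg hz; exact inv_nonneg.2 (by linarith))

theorem refMetric_posDef (hr : IsStrictlyPshDefiningFunction Ω r) (hz : z ∈ Ω) :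
    (refMetric r z).PosDef := by
  rw [hr.refMetric_eq hz]
  have h : 0 < (-r z)⁻¹ := inv_pos.2 (neg_pos.2 (hr.neg hz))
  refine Matrix.PosDef.add_posSemidef ((hr.posDef z (subset_closure hz)).smul (by
    rw [Complex.zero_lt_real]; exact h)) ((Matrix.posSemidef_vecMulVec_self_star _).smul (by
    rw [Complex.zero_le_real]; positivity))

/-- The squared length of `∂r` with respect to the metric `∂∂̄r`. -/
def gradSq (r : (Fin n → ℂ) → ℝ) (z : Fin n → ℂ) : ℝ :=
  (star (complexGradient r z) ⬝ᵥ (complexHessian r z)⁻¹.mulVec (complexGradient r z)).re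

/-- The function `J` with `det (∂∂̄(-log(-r))) = (-r)^{-(n+1)} J`. -/
def feffermanJ (r : (Fin n → ℂ) → ℝ) (z : Fin n → ℂ) : ℝ :=
  (complexHessian r z).det.re * (-r z + gradSq r z)

/-- Where `r < 0` the term `-r` is positive; where `r = 0` the gradient does not vanish. Positivity
on the whole closure makes `log J` smooth up to the boundary. -/
theorem feffermanJ_pos (hr : IsStrictlyPshDefiningFunction Ω r) (hz : z ∈ closure Ω) :
    0 < feffermanJ r z := by
  have hH := hr.posDef z hz
  refine mul_pos (det_re_pos hH) ?_
  have h1 : 0 ≤ gradSq r z := (Complex.le_def.1 (hH.inv.posSemidef.dotProduct_mulVec_nonneg _)).1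
  rcases (hr.nonpos hz).lt_or_eq with h | h
  · linarith
  · have h2 : complexGradient r z ≠ 0 := fun h3 => hr.fderiv_ne_zero_of_eq_zero hz h
      (fderiv_eq_zero_of_complexGradient_eq_zero ((hr.contDiffAt hz).differentiableAt (by simp)) h3)
    have h3 : 0 < gradSq r z := (Complex.lt_def.1 (hH.inv.dotProduct_mulVec_pos h2)).1
    linarith

theorem contDiffAt_feffermanJ (hr : IsStrictlyPshDefiningFunction Ω r) (hz : z ∈ closure Ω) :
    ContDiffAt ℝ ∞ (feffermanJ r) z := by
  have hrz := hr.contDiffAt hz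
  have hH : ∀ i j, ContDiffWithinAt ℝ ∞ (fun w => complexHessian r w i j) univ z := fun i j =>
    contDiffWithinAt_univ.2 (contDiffAt_complexHessian hrz (by simp) i j)
  have hg : ∀ c i, ContDiffAt ℝ ∞ (wirtinger c i (fun w => (r w : ℂ))) z := fun c i =>
    contDiffAt_wirtinger (contDiffAt_ofReal hrz) (by simp)
  have h1 : ContDiffAt ℝ ∞ (fun w => (complexHessian r w).det.re) z :=
    Complex.reCLM.contDiff.contDiffAt.comp z (contDiffWithinAt_univ.1 (contDiffWithinAt_det hH))
  have h2 : ContDiffAt ℝ ∞ (gradSq r) z := by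
    refine Complex.reCLM.contDiff.contDiffAt.comp z ?_
    simp only [dotProduct, Matrix.mulVec, Pi.star_apply, complexGradient, star_wirtinger_ofReal]
    exact ContDiffAt.sum fun i _ => (hg _ i).mul (ContDiffAt.sum fun j _ =>
      (contDiffWithinAt_univ.1 (contDiffWithinAt_inv hH (isUnit_det (hr.posDef z hz)) i j)).mul
        (hg _ j))
  exact h1.mul (hrz.neg.add h2)

/-- Once `1/(-r)` is factored out, the metric is a rank-one perturbation of `∂∂̄r`, to which the
matrix determinant lemma applies. -/
theorem det_refMetric (hr : IsStrictlyPshDefiningFunction Ω r) (hz : z ∈ Ω) :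
    (refMetric r z).det.re = (-r z)⁻¹ ^ (n + 1) * feffermanJ r z := by
  have hH := hr.posDef z (subset_closure hz)
  have hneg := hr.neg hz
  set u := complexGradient r z with hu
  set ρ : ℝ := (-r z)⁻¹ with hρ
  have hρr : ρ * (-r z) = 1 := inv_mul_cancel₀ (by linarith)
  have e1 : refMetric r z = (ρ : ℂ) • (complexHessian r z +
      Matrix.replicateCol Unit ((ρ : ℂ) • u) * Matrix.replicateRow Unit (star u)) := by
    rw [hr.refMetric_eq hz, smul_add, ← Matrix.vecMulVec_eq, Matrix.smul_vecMulVec, smul_smul, sq,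
      Complex.ofReal_mul]
  have hq : star u ⬝ᵥ (complexHessian r z)⁻¹.mulVec u = (gradSq r z : ℂ) :=
    Complex.ext rfl (by
      have := (Complex.le_def.1 (hH.inv.posSemidef.dotProduct_mulVec_nonneg u)).2
      simpa using this.symm)
  have e2 : (1 + Matrix.replicateRow Unit (star u) * (complexHessian r z)⁻¹ *
      Matrix.replicateCol Unit ((ρ : ℂ) • u)).det = 1 + (ρ : ℂ) * (gradSq r z : ℂ) := by
    rw [Matrix.det_unique, Matrix.add_apply, Matrix.one_apply_eq, Matrix.mul_assoc,
      ← Matrix.replicateCol_mulVec, Matrix.replicateRow_mul_replicateCol_apply, Matrix.mulVec_smul,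
      dotProduct_smul, hq, smul_eq_mul]
  rw [e1, Matrix.det_smul, Fintype.card_fin, Matrix.det_add_replicateCol_mul_replicateRow
    (isUnit_det hH), e2, ← ofReal_det_re hH]
  have e3 : ((ρ : ℂ) ^ n * (((complexHessian r z).det.re : ℂ) * (1 + ρ * gradSq r z))) =
      ((ρ ^ n * ((complexHessian r z).det.re * (1 + ρ * gradSq r z)) : ℝ) : ℂ) := by
    push_cast; ring
  rw [e3, Complex.ofReal_re, feffermanJ, ← hρr]
  ring

/-- The scalar curvature of the reference metric is bounded below. -/
theorem exists_laplacian_log_det_le (hr : IsStrictlyPshDefiningFunction Ω r) :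
    ∃ A : ℝ, ∀ z ∈ Ω, laplacian (refMetric r) (fun w => Real.log (refMetric r w).det.re) z ≤ A := by
  have hJ : ∀ z ∈ closure Ω, ContDiffAt ℝ ∞ (fun w => Real.log (feffermanJ r w)) z := fun z hz =>
    (hr.contDiffAt_feffermanJ hz).log (hr.feffermanJ_pos hz).ne'
  have h2 := two_le_infty
  obtain ⟨k, hk0, hk⟩ := exists_smul_sub_posSemidef hr.isCompact_closure
    (A := complexHessian r) (X := complexHessian (fun w => Real.log (feffermanJ r w)))
    (continuousOn_of_forall_continuousAt fun z hz =>
      continuousAt_complexHessian ((hr.contDiffAt hz).of_le h2))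
    (continuousOn_of_forall_continuousAt fun z hz =>
      continuousAt_complexHessian ((hJ z hz).of_le h2)) hr.posDef
    (fun z hz => complexHessian_isHermitian ((hJ z hz).of_le h2))
  obtain ⟨m, hm⟩ := (hr.isCompact_closure.image_of_continuousOn hr.continuousOn_closure).bddBelow
  set M := max (-m) 0 with hM
  refine ⟨((n + 1) + k * M) * n, fun z hz => ?_⟩
  have hzc := subset_closure hz
  have hneg := hr.neg hz
  have hrM : -r z ≤ M := (neg_le_neg (hm ⟨z, hzc, rfl⟩)).trans (le_max_left _ _)
  refine trace_inv_mul_re_le (hr.refMetric_posDef hz) ?_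
  -- Since `log det ω = (n+1)φ + log J`, only `∂∂̄ log J` remains to be compared with `ω`.
  have e : complexHessian (fun w => Real.log (refMetric r w).det.re) z =
      (((n + 1 : ℝ)) : ℂ) • refMetric r z +
        complexHessian (fun w => Real.log (feffermanJ r w)) z := by
    have e1 : (fun w => Real.log (refMetric r w).det.re) =ᶠ[𝓝 z]
        fun w => (n + 1 : ℝ) * refPotential r w + Real.log (feffermanJ r w) := by
      filter_upwards [hr.isOpen.mem_nhds hz] with w hw
      rw [hr.det_refMetric hw, Real.log_mul (pow_ne_zero _ (inv_ne_zero (by linarith [hr.neg hw])))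
        (hr.feffermanJ_pos (subset_closure hw)).ne', Real.log_pow, Real.log_inv, refPotential]
      push_cast; ring
    have hφ := (hr.contDiffAt_refPotential hz).of_le h2
    rw [complexHessian_congr e1, complexHessian_add (contDiffAt_const.mul hφ) ((hJ z hzc).of_le h2),
      complexHessian_const_mul _ hφ]
    rfl
  -- Compactness of the closure gives `∂∂̄ log J ≤ k ∂∂̄r`. Moreover `∂∂̄r ≤ (-r) ω ≤ M ω`, so the
  -- constant is `(n+1) + kM`; the right side displays the difference as a sum of three positive
  -- semidefinite forms.
  have key : ((((n + 1) + k * M : ℝ)) : ℂ) • refMetric r z -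
      complexHessian (fun w => Real.log (refMetric r w).det.re) z =
      ((k * M : ℝ) : ℂ) • (refMetric r z - (((-r z)⁻¹ : ℝ) : ℂ) • complexHessian r z) +
      ((k * M * (-r z)⁻¹ - k : ℝ) : ℂ) • complexHessian r z +
      ((k : ℂ) • complexHessian r z - complexHessian (fun w => Real.log (feffermanJ r w)) z) := by
    rw [e]
    push_cast
    module
  rw [key]
  have h3 : 0 ≤ k * M := mul_nonneg hk0 (le_max_right _ _)
  have h4 : 0 ≤ k * M * (-r z)⁻¹ - k := by
    have : 1 ≤ M * (-r z)⁻¹ := by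
      rw [← div_eq_mul_inv, le_div_iff₀ (by linarith)]; linarith
    nlinarith
  exact (((hr.refMetric_sub_posSemidef hz).smul (by rwa [Complex.zero_le_real])).add
    ((hr.posDef z hzc).posSemidef.smul (by rwa [Complex.zero_le_real]))).add (hk z hzc)

end IsStrictlyPshDefiningFunction

/-! ### Slices of functions on space-time -/

section SpaceTime

variable {Ω : Set (Fin n → ℂ)} {I : Set ℝ} {W : Type*} [NormedAddCommGroup W] [NormedSpace ℝ W]
  {F : (Fin n → ℂ) → ℝ → W} {z : Fin n → ℂ} {t : ℝ}

theorem contDiffAt_slice {k : ℕ∞ω} (hΩ : IsOpen Ω)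
    (hF : ContDiffOn ℝ k (fun p : (Fin n → ℂ) × ℝ => F p.1 p.2) (Ω ×ˢ I)) (hz : z ∈ Ω) (ht : t ∈ I) :
    ContDiffAt ℝ k (fun w => F w t) z := by
  have h : ContDiffOn ℝ k (fun w => F w t) Ω :=
    hF.comp (f := fun w => (w, t)) (contDiff_id.prodMk contDiff_const).contDiffOn
      fun w hw => ⟨hw, ht⟩
  exact h.contDiffAt (hΩ.mem_nhds hz)

/-- The derivative within `Ω × I` is used because `I` need not be a neighbourhood of `t`, as at `t =
0`; spatial derivatives then stay jointly smooth up to the initial time. -/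
theorem fderiv_slice_eq (hΩ : IsOpen Ω)
    (hF : ContDiffOn ℝ ∞ (fun p : (Fin n → ℂ) × ℝ => F p.1 p.2) (Ω ×ˢ I)) (hz : z ∈ Ω) (ht : t ∈ I)
    (v : Fin n → ℂ) : fderiv ℝ (fun w => F w t) z v =
      fderivWithin ℝ (fun p : (Fin n → ℂ) × ℝ => F p.1 p.2) (Ω ×ˢ I) (z, t) (v, 0) := by
  have h1 : HasFDerivWithinAt (fun p : (Fin n → ℂ) × ℝ => F p.1 p.2) _ (Ω ×ˢ I) (z, t) :=
    ((hF.differentiableOn (by simp)) (z, t) ⟨hz, ht⟩).hasFDerivWithinAt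
  have h2 : HasFDerivWithinAt (fun w : Fin n → ℂ => (w, t))
      (ContinuousLinearMap.inl ℝ (Fin n → ℂ) ℝ) Ω z :=
    (hasFDerivAt_prodMk_left z t).hasFDerivWithinAt
  have hm : MapsTo (fun w : Fin n → ℂ => (w, t)) Ω (Ω ×ˢ I) := fun w hw => ⟨hw, ht⟩
  have h3 := (h1.comp z h2 hm).hasFDerivAt (hΩ.mem_nhds hz)
  have h4 : fderiv ℝ (fun w => F w t) z = _ := h3.fderiv
  rw [h4]
  rfl

theorem contDiffOn_fderiv_slice (hΩ : IsOpen Ω) (hI : UniqueDiffOn ℝ I)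
    (hF : ContDiffOn ℝ ∞ (fun p : (Fin n → ℂ) × ℝ => F p.1 p.2) (Ω ×ˢ I)) (v : Fin n → ℂ) :
    ContDiffOn ℝ ∞ (fun p : (Fin n → ℂ) × ℝ => fderiv ℝ (fun w => F w p.2) p.1 v) (Ω ×ˢ I) := by
  have h1 := hF.fderivWithin (hΩ.uniqueDiffOn.prod hI) (m := ∞) (by simp)
  refine (h1.clm_apply (contDiffOn_const (c := (v, (0 : ℝ))))).congr fun p hp => ?_
  exact fderiv_slice_eq hΩ hF hp.1 hp.2 v

theorem contDiffOn_wirtinger_slice {F : (Fin n → ℂ) → ℝ → ℂ} (hΩ : IsOpen Ω) (hI : UniqueDiffOn ℝ I)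
    (hF : ContDiffOn ℝ ∞ (fun p : (Fin n → ℂ) × ℝ => F p.1 p.2) (Ω ×ˢ I)) (c : ℂ) (α : Fin n) :
    ContDiffOn ℝ ∞ (fun p : (Fin n → ℂ) × ℝ => wirtinger c α (fun w => F w p.2) p.1) (Ω ×ˢ I) :=
  contDiffOn_const.mul ((contDiffOn_fderiv_slice hΩ hI hF _).add
    (contDiffOn_const.mul (contDiffOn_fderiv_slice hΩ hI hF _)))

theorem contDiffOn_complexHessian_slice {F : (Fin n → ℂ) → ℝ → ℝ} (hΩ : IsOpen Ω)
    (hI : UniqueDiffOn ℝ I)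
    (hF : ContDiffOn ℝ ∞ (fun p : (Fin n → ℂ) × ℝ => F p.1 p.2) (Ω ×ˢ I)) (i j : Fin n) :
    ContDiffOn ℝ ∞ (fun p : (Fin n → ℂ) × ℝ => complexHessian (fun w => F w p.2) p.1 i j)
      (Ω ×ˢ I) := by
  simp only [complexHessian_apply]
  exact contDiffOn_wirtinger_slice (F := fun w t => wirtinger Complex.I j (fun w => (F w t : ℂ)) w)
    hΩ hI (contDiffOn_wirtinger_slice (F := fun w t => (F w t : ℂ)) hΩ hI
      (Complex.ofRealCLM.contDiff.comp_contDiffOn hF) _ _) _ _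

theorem contDiffAt_spaceTime (hΩ : IsOpen Ω)
    (hF : ContDiffOn ℝ ∞ (fun p : (Fin n → ℂ) × ℝ => F p.1 p.2) (Ω ×ˢ I)) (hz : z ∈ Ω)
    (ht : I ∈ 𝓝 t) : ContDiffAt ℝ ∞ (fun p : (Fin n → ℂ) × ℝ => F p.1 p.2) (z, t) :=
  hF.contDiffAt (prod_mem_nhds (hΩ.mem_nhds hz) ht)

theorem hasDerivAt_slice (hΩ : IsOpen Ω)
    (hF : ContDiffOn ℝ ∞ (fun p : (Fin n → ℂ) × ℝ => F p.1 p.2) (Ω ×ˢ I)) (hz : z ∈ Ω)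
    (ht : I ∈ 𝓝 t) :
    HasDerivAt (fun s => F z s) (fderiv ℝ (fun p : (Fin n → ℂ) × ℝ => F p.1 p.2) (z, t) (0, 1)) t := by
  have h1 := ((contDiffAt_spaceTime hΩ hF hz ht).differentiableAt (by simp)).hasFDerivAt
  exact (h1.comp t (hasFDerivAt_prodMk_right z t)).hasDerivAt.congr_deriv (by simp)

/-- Time derivatives commute with spatial derivatives. -/
theorem hasDerivAt_fderiv_slice (hΩ : IsOpen Ω)
    (hF : ContDiffOn ℝ ∞ (fun p : (Fin n → ℂ) × ℝ => F p.1 p.2) (Ω ×ˢ I)) (hz : z ∈ Ω)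
    (ht : I ∈ 𝓝 t) (v : Fin n → ℂ) :
    HasDerivAt (fun s => fderiv ℝ (fun w => F w s) z v)
      (fderiv ℝ (fun w => deriv (fun s => F w s) t) z v) t := by
  set Φ : (Fin n → ℂ) × ℝ → W := fun p => F p.1 p.2 with hΦ
  have hC := contDiffAt_spaceTime hΩ hF hz ht
  have hd : HasFDerivAt (fderiv ℝ Φ) (fderiv ℝ (fderiv ℝ Φ) (z, t)) (z, t) :=
    ((hC.fderiv_right (m := ∞) (by simp)).differentiableAt (by simp)).hasFDerivAt
  -- Symmetry of the joint second derivative in the time direction `(0, 1)` and the space direction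
  -- `(v, 0)` is the whole content.
  have hsym := (hC.isSymmSndFDerivAt (by simpa using two_le_infty)).eq ((0 : Fin n → ℂ), (1 : ℝ)) (v, 0)
  have e1 : (fun s => fderiv ℝ (fun w => F w s) z v) =ᶠ[𝓝 t] fun s => fderiv ℝ Φ (z, s) (v, 0) := by
    filter_upwards [eventually_mem_nhds_iff.2 ht] with s hs
    have h1 : HasFDerivAt Φ (fderiv ℝ Φ (z, s)) (z, s) :=
      ((contDiffAt_spaceTime hΩ hF hz hs).differentiableAt (by simp)).hasFDerivAt
    have h2 : HasFDerivAt (fun w => F w s)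
        ((fderiv ℝ Φ (z, s)).comp (ContinuousLinearMap.inl ℝ (Fin n → ℂ) ℝ)) z :=
      HasFDerivAt.comp (g := Φ) (f := fun w : Fin n → ℂ => (w, s)) z h1
        (hasFDerivAt_prodMk_left (𝕜 := ℝ) z s)
    rw [h2.fderiv]
    rfl
  have e2 : (fun w => deriv (fun s => F w s) t) =ᶠ[𝓝 z] fun w => fderiv ℝ Φ (w, t) (0, 1) := by
    filter_upwards [hΩ.mem_nhds hz] with w hw using (hasDerivAt_slice hΩ hF hw ht).deriv
  have h3 : HasFDerivAt (fun w => fderiv ℝ Φ (w, t) (0, 1)) _ z :=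
    (hd.comp z (hasFDerivAt_prodMk_left z t)).clm_apply
      (hasFDerivAt_const ((0 : Fin n → ℂ), (1 : ℝ)) z)
  have h4 : HasFDerivAt (fun s => fderiv ℝ Φ (z, s) (v, 0)) _ t :=
    (hd.comp t (hasFDerivAt_prodMk_right z t)).clm_apply (hasFDerivAt_const (v, (0 : ℝ)) t)
  refine (h4.hasDerivAt.congr_of_eventuallyEq e1).congr_deriv ?_
  rw [e2.fderiv_eq, h3.fderiv]
  simpa using hsym

theorem hasDerivAt_wirtinger_slice {F : (Fin n → ℂ) → ℝ → ℂ} (hΩ : IsOpen Ω)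
    (hF : ContDiffOn ℝ ∞ (fun p : (Fin n → ℂ) × ℝ => F p.1 p.2) (Ω ×ˢ I)) (hz : z ∈ Ω)
    (ht : I ∈ 𝓝 t) (c : ℂ) (α : Fin n) :
    HasDerivAt (fun s => wirtinger c α (fun w => F w s) z)
      (wirtinger c α (fun w => deriv (fun s => F w s) t) z) t :=
  ((hasDerivAt_fderiv_slice hΩ hF hz ht _).add
    ((hasDerivAt_fderiv_slice hΩ hF hz ht _).const_mul c)).const_mul (1 / 2 : ℂ)

theorem hasDerivAt_complexHessian_slice {F : (Fin n → ℂ) → ℝ → ℝ} (hΩ : IsOpen Ω)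
    (hI : UniqueDiffOn ℝ I)
    (hF : ContDiffOn ℝ ∞ (fun p : (Fin n → ℂ) × ℝ => F p.1 p.2) (Ω ×ˢ I)) (hz : z ∈ Ω)
    (ht : I ∈ 𝓝 t) (i j : Fin n) :
    HasDerivAt (fun s => complexHessian (fun w => F w s) z i j)
      (complexHessian (fun w => deriv (fun s => F w s) t) z i j) t := by
  have hFC : ContDiffOn ℝ ∞ (fun p : (Fin n → ℂ) × ℝ => (F p.1 p.2 : ℂ)) (Ω ×ˢ I) :=
    Complex.ofRealCLM.contDiff.comp_contDiffOn hF
  have h1 := hasDerivAt_wirtinger_slice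
    (F := fun w s => wirtinger Complex.I j (fun w => (F w s : ℂ)) w) hΩ
    (contDiffOn_wirtinger_slice (F := fun w s => (F w s : ℂ)) hΩ hI hFC Complex.I j) hz ht
    (-Complex.I) i
  simp only [complexHessian_apply]
  refine h1.congr_deriv (wirtinger_congr ?_)
  filter_upwards [hΩ.mem_nhds hz] with w hw
  rw [(hasDerivAt_wirtinger_slice (F := fun w s => (F w s : ℂ)) hΩ hFC hw ht Complex.I j).deriv]
  refine wirtinger_congr ?_
  filter_upwards [hΩ.mem_nhds hw] with x hx
  have h2 := hasDerivAt_slice hΩ hF hx ht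
  rw [h2.deriv]
  exact h2.ofReal_comp.deriv

end SpaceTime

/-! ### The complex Hessian at a local maximum -/

section SecondDerivativeTest

theorem sum_mul_wirtinger (h : (Fin n → ℂ) → ℂ) (z u : Fin n → ℂ) :
    ∑ α, u α * wirtinger (-Complex.I) α h z =
      (1 / 2 : ℂ) * (fderiv ℝ h z u - Complex.I * fderiv ℝ h z (Complex.I • u)) := by
  have hu : ∀ v : Fin n → ℂ, v = ∑ α, ((v α).re • (Pi.single α 1 : Fin n → ℂ) +
      (v α).im • (Pi.single α Complex.I : Fin n → ℂ)) := by
    intro v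
    ext β
    rw [Finset.sum_apply, Finset.sum_eq_single β]
    · simp
    · intro γ _ hγ
      simp [Pi.single_eq_of_ne (Ne.symm hγ)]
    · simp
  have hL : ∀ v : Fin n → ℂ, fderiv ℝ h z v = ∑ α, ((v α).re * fderiv ℝ h z (Pi.single α 1) +
      (v α).im * fderiv ℝ h z (Pi.single α Complex.I)) := by
    intro v
    conv_lhs => rw [hu v]
    simp only [map_sum, map_add, map_smul, Complex.real_smul]
  rw [hL u, hL (Complex.I • u), Finset.mul_sum, ← Finset.sum_sub_distrib, Finset.mul_sum]
  refine Finset.sum_congr rfl fun α _ => ?_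
  simp only [wirtinger, wirtingerForm, LinearMap.coe_mk, AddHom.coe_mk, Pi.smul_apply, smul_eq_mul,
    Complex.I_mul_re, Complex.I_mul_im, Complex.ofReal_neg]
  conv_lhs => rw [← Complex.re_add_im (u α)]
  linear_combination ((u α).im / 2 * fderiv ℝ h z (Pi.single α 1) * 0 -
    (u α).im / 2 * fderiv ℝ h z (Pi.single α Complex.I)) * Complex.I_sq

/-- If `f''(x)` were positive, `x` would also be a local minimum, so `f` would be constant near `x`
and `f''(x)` would vanish. -/
theorem deriv_deriv_nonpos_of_isLocalMax {f : ℝ → ℝ} {x : ℝ} (hf : ContinuousAt f x)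
    (h : IsLocalMax f x) : deriv (deriv f) x ≤ 0 := by
  by_contra! hpos
  have hmin := isLocalMin_of_deriv_deriv_pos hpos h.deriv_eq_zero hf
  have e : f =ᶠ[𝓝 x] fun _ => f x := by
    filter_upwards [h, hmin] with y h1 h2 using le_antisymm h1 h2
  have e2 : deriv f =ᶠ[𝓝 x] fun _ => 0 := by
    filter_upwards [e.eventuallyEq_nhds] with y hy
    rw [hy.deriv_eq, deriv_const]
  rw [e2.deriv_eq, deriv_const] at hpos
  exact lt_irrefl _ hpos

theorem fderiv_fderiv_nonpos_of_isLocalMax {f : (Fin n → ℂ) → ℝ} {z : Fin n → ℂ}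
    (hf : ContDiffAt ℝ 2 f z) (h : IsLocalMax f z) (u : Fin n → ℂ) :
    fderiv ℝ (fderiv ℝ f) z u u ≤ 0 := by
  let ℓ : ℝ → (Fin n → ℂ) := fun s => z + s • u
  have hℓ0 : ℓ 0 = z := by simp [ℓ]
  have hℓ : ∀ s, HasDerivAt ℓ u s := fun s => by
    simpa [ℓ] using ((hasDerivAt_id s).smul_const u).const_add z
  have hℓc : Tendsto ℓ (𝓝 0) (𝓝 z) := by
    have := (hℓ 0).continuousAt.tendsto
    rwa [hℓ0] at this
  have h1 : IsLocalMax (f ∘ ℓ) 0 := by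
    have : ∀ᶠ s in 𝓝 (0 : ℝ), f (ℓ s) ≤ f z := hℓc.eventually h
    simpa [IsLocalMax, IsMaxFilter, hℓ0] using this
  have hd : ∀ᶠ s in 𝓝 (0 : ℝ), DifferentiableAt ℝ f (ℓ s) :=
    hℓc.eventually ((hf.eventually (by simp)).mono fun w hw => hw.differentiableAt (by norm_num))
  have e1 : deriv (f ∘ ℓ) =ᶠ[𝓝 0] fun s => fderiv ℝ f (ℓ s) u :=
    hd.mono fun s hs => (hs.hasFDerivAt.comp_hasDerivAt s (hℓ s)).deriv
  have hd2 : HasFDerivAt (fderiv ℝ f) (fderiv ℝ (fderiv ℝ f) z) (ℓ 0) := by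
    rw [hℓ0]
    exact ((hf.fderiv_right (m := 1) (by norm_num)).differentiableAt (by norm_num)).hasFDerivAt
  have h2 := (hd2.comp_hasDerivAt 0 (hℓ 0)).clm_apply (hasDerivAt_const (0 : ℝ) u)
  have h3 : deriv (fun s => fderiv ℝ f (ℓ s) u) 0 = fderiv ℝ (fderiv ℝ f) z u u := by
    rw [show (fun s => fderiv ℝ f (ℓ s) u) = fun s => (fderiv ℝ f ∘ ℓ) s u from rfl, h2.deriv]
    simp
  rw [← h3, ← e1.deriv_eq]
  refine deriv_deriv_nonpos_of_isLocalMax ?_ h1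
  have : ContinuousAt f (ℓ 0) := by rw [hℓ0]; exact hf.continuousAt
  exact this.comp (hℓ 0).continuousAt

/-- With `u` the conjugate of `x`, the Hermitian form of the complex Hessian at `x` is a quarter of
the sum of the real second derivatives along `u` and `iu`, both nonpositive at a maximum. -/
theorem neg_complexHessian_posSemidef_of_isLocalMax {f : (Fin n → ℂ) → ℝ} {z : Fin n → ℂ}
    (hf : ContDiffAt ℝ 2 f z) (h : IsLocalMax f z) : (-complexHessian f z).PosSemidef := by
  have hH := complexHessian_isHermitian hf
  refine Matrix.PosSemidef.of_dotProduct_mulVec_nonneg hH.neg fun x => ?_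
  have him : (star x ⬝ᵥ (-complexHessian f z).mulVec x).im = 0 := by
    have := hH.neg.im_star_dotProduct_mulVec_self x
    simpa using this
  rw [Complex.le_def]
  refine ⟨?_, by simpa using him.symm⟩
  set u : Fin n → ℂ := star x with hu
  have hd : ∀ᶠ w in 𝓝 z, DifferentiableAt ℝ f w :=
    (hf.eventually (by simp)).mono fun w hw => hw.differentiableAt (by norm_num)
  have hfd : ∀ w, DifferentiableAt ℝ f w → ∀ v,
      fderiv ℝ (fun w => (f w : ℂ)) w v = (fderiv ℝ f w v : ℂ) := fun w hw v => by
    have h1 : HasFDerivAt (fun w => (f w : ℂ)) (Complex.ofRealCLM.comp (fderiv ℝ f w)) w :=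
      Complex.ofRealCLM.hasFDerivAt.comp w hw.hasFDerivAt
    rw [h1.fderiv]
    rfl
  have hd2 : HasFDerivAt (fderiv ℝ f) (fderiv ℝ (fderiv ℝ f) z) z :=
    ((hf.fderiv_right (m := 1) (by norm_num)).differentiableAt (by norm_num)).hasFDerivAt
  have hdv : ∀ v, HasFDerivAt (fun w => ((fderiv ℝ f w v : ℝ) : ℂ))
      (Complex.ofRealCLM.comp ((fderiv ℝ (fderiv ℝ f) z).flip v)) z := fun v => by
    refine Complex.ofRealCLM.hasFDerivAt.comp z ?_
    refine (hd2.clm_apply (hasFDerivAt_const v z)).congr_fderiv ?_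
    ext; simp
  have hwd : ∀ β, DifferentiableAt ℝ (wirtinger Complex.I β (fun w => (f w : ℂ))) z := fun β =>
    (contDiffAt_wirtinger (m := 1) (contDiffAt_ofReal hf) (by norm_num)).differentiableAt
      (by norm_num)
  have e1 : (fun w => ∑ β, x β * wirtinger Complex.I β (fun w => (f w : ℂ)) w) =ᶠ[𝓝 z]
      fun w => (1 / 2 : ℂ) * ((fderiv ℝ f w u : ℂ) +
        Complex.I * (fderiv ℝ f w (Complex.I • u) : ℂ)) := by
    filter_upwards [hd] with w hw
    have h1 := congrArg star (sum_mul_wirtinger (fun w => (f w : ℂ)) w u)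
    rw [star_sum, hfd w hw, hfd w hw] at h1
    have h2 : ∑ β, x β * wirtinger Complex.I β (fun w => (f w : ℂ)) w =
        ∑ β, star (u β * wirtinger (-Complex.I) β (fun w => (f w : ℂ)) w) := by
      refine Finset.sum_congr rfl fun β _ => ?_
      rw [star_mul', star_wirtinger_ofReal, hu]
      simp
    rw [h2, h1]
    simp
  have e2 : u ⬝ᵥ (complexHessian f z).mulVec x = ∑ α, u α * wirtinger (-Complex.I) α
      (fun w => ∑ β, x β * wirtinger Complex.I β (fun w => (f w : ℂ)) w) z := by
    simp only [dotProduct, Matrix.mulVec]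
    refine Finset.sum_congr rfl fun α _ => ?_
    rw [wirtinger_sum fun β _ => (hwd β).const_mul (x β)]
    congr 1
    refine Finset.sum_congr rfl fun β _ => ?_
    rw [wirtinger_const_mul _ (hwd β), complexHessian_apply, mul_comm]
  have h3 : HasFDerivAt (fun w => (1 / 2 : ℂ) * ((fderiv ℝ f w u : ℂ) +
        Complex.I * (fderiv ℝ f w (Complex.I • u) : ℂ))) _ z :=
    ((hdv u).add ((hdv (Complex.I • u)).const_mul Complex.I)).const_mul (1 / 2 : ℂ)
  have e3 : (u ⬝ᵥ (complexHessian f z).mulVec x).re = (1 / 4 : ℝ) *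
      (fderiv ℝ (fderiv ℝ f) z u u +
        fderiv ℝ (fderiv ℝ f) z (Complex.I • u) (Complex.I • u)) := by
    rw [e2, Finset.sum_congr rfl fun α _ => by rw [wirtinger_congr e1], sum_mul_wirtinger,
      h3.fderiv]
    simp
    ring
  rw [Matrix.neg_mulVec, dotProduct_neg, Complex.neg_re, e3, Complex.zero_re]
  linarith [fderiv_fderiv_nonpos_of_isLocalMax hf h u,
    fderiv_fderiv_nonpos_of_isLocalMax hf h (Complex.I • u)]

theorem laplacian_nonpos_of_isLocalMax {G : (Fin n → ℂ) → Matrix (Fin n) (Fin n) ℂ}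
    {f : (Fin n → ℂ) → ℝ} {z : Fin n → ℂ} (hG : (G z).PosDef) (hf : ContDiffAt ℝ 2 f z)
    (h : IsLocalMax f z) : laplacian G f z ≤ 0 := by
  have := trace_mul_re_nonneg hG.inv.posSemidef (neg_complexHessian_posSemidef_of_isLocalMax hf h)
  rw [Matrix.mul_neg, Matrix.trace_neg, Complex.neg_re] at this
  exact neg_nonneg.1 this

end SecondDerivativeTest

/-! ### The time interval -/

section TimeInterval

variable {T : EReal} {t : ℝ}

theorem timeInterval_mem_nhds (ht : t ∈ timeInterval T) (h0 : 0 < t) : timeInterval T ∈ 𝓝 t := by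
  filter_upwards [lt_mem_nhds h0,
    continuous_coe_real_ereal.continuousAt.eventually (gt_mem_nhds ht.2)] with s h1 h2
    using ⟨h1.le, h2⟩

theorem Icc_subset_timeInterval (ht : t ∈ timeInterval T) : Icc 0 t ⊆ timeInterval T :=
  fun _ hs => ⟨hs.1, (EReal.coe_le_coe_iff.2 hs.2).trans_lt ht.2⟩

theorem uniqueDiffOn_timeInterval (hT : 0 < T) : UniqueDiffOn ℝ (timeInterval T) := by
  have hconv : (timeInterval T).OrdConnected := ⟨fun a ha b hb c hc =>
    ⟨ha.1.trans hc.1, (EReal.coe_le_coe_iff.2 hc.2).trans_lt hb.2⟩⟩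
  refine uniqueDiffOn_convex hconv.convex ?_
  obtain ⟨q, hq0, hqT⟩ := EReal.lt_iff_exists_real_btwn.1 hT
  have hq : 0 < q := by exact_mod_cast hq0
  exact ⟨q, mem_interior_iff_mem_nhds.2 (timeInterval_mem_nhds ⟨hq.le, hqT⟩ hq)⟩

end TimeInterval

/-! ### Evolution of the volume density along the flow -/

/-- The logarithm of the volume density of `ω(t)`. -/
def logDet (g : (Fin n → ℂ) → ℝ → ℝ) (z : Fin n → ℂ) (t : ℝ) : ℝ :=
  Real.log (metric g t z).det.re

/-- The logarithmic time derivative `Δ_t log det g(t) - n(n+1)` of the volume density along the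
normalized Kähler–Ricci flow. -/
def volumeRate (g : (Fin n → ℂ) → ℝ → ℝ) (z : Fin n → ℂ) (t : ℝ) : ℝ :=
  laplacian (metric g t) (fun w => logDet g w t) z - n * (n + 1)

namespace IsKahlerRicciFlow

variable {Ω : Set (Fin n → ℂ)} {r : (Fin n → ℂ) → ℝ} {T : EReal} {g : (Fin n → ℂ) → ℝ → ℝ}
  {z : Fin n → ℂ} {t : ℝ}

theorem contDiffOn_metric (hg : IsKahlerRicciFlow Ω r T g) (hΩ : IsOpen Ω) (hT : 0 < T)
    (i j : Fin n) : ContDiffOn ℝ ∞ (fun p : (Fin n → ℂ) × ℝ => metric g p.2 p.1 i j)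
      (Ω ×ˢ timeInterval T) :=
  contDiffOn_complexHessian_slice hΩ (uniqueDiffOn_timeInterval hT) hg.smooth i j

theorem contDiffOn_det (hg : IsKahlerRicciFlow Ω r T g) (hΩ : IsOpen Ω) (hT : 0 < T) :
    ContDiffOn ℝ ∞ (fun p : (Fin n → ℂ) × ℝ => (metric g p.2 p.1).det.re)
      (Ω ×ˢ timeInterval T) := fun p hp =>
  Complex.reCLM.contDiff.contDiffAt.comp_contDiffWithinAt p
    (contDiffWithinAt_det fun i j => hg.contDiffOn_metric hΩ hT i j p hp)

theorem contDiffOn_logDet (hg : IsKahlerRicciFlow Ω r T g) (hΩ : IsOpen Ω) (hT : 0 < T) :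
    ContDiffOn ℝ ∞ (fun p : (Fin n → ℂ) × ℝ => logDet g p.1 p.2) (Ω ×ˢ timeInterval T) :=
  (hg.contDiffOn_det hΩ hT).log fun p hp => (det_re_pos (hg.posDef p.2 hp.2 p.1 hp.1)).ne'

theorem contDiffOn_laplacian (hg : IsKahlerRicciFlow Ω r T g) (hΩ : IsOpen Ω) (hT : 0 < T)
    {F : (Fin n → ℂ) → ℝ → ℝ}
    (hF : ContDiffOn ℝ ∞ (fun p : (Fin n → ℂ) × ℝ => F p.1 p.2) (Ω ×ˢ timeInterval T)) :
    ContDiffOn ℝ ∞ (fun p : (Fin n → ℂ) × ℝ => laplacian (metric g p.2) (fun w => F w p.2) p.1)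
      (Ω ×ˢ timeInterval T) := fun p hp =>
  contDiffWithinAt_trace_inv_mul (G := fun p : (Fin n → ℂ) × ℝ => metric g p.2 p.1)
    (H := fun p : (Fin n → ℂ) × ℝ => complexHessian (fun w => F w p.2) p.1)
    (fun i j => hg.contDiffOn_metric hΩ hT i j p hp)
    (isUnit_det (hg.posDef p.2 hp.2 p.1 hp.1))
    (fun i j => contDiffOn_complexHessian_slice hΩ (uniqueDiffOn_timeInterval hT) hF i j p hp)

theorem contDiffOn_volumeRate (hg : IsKahlerRicciFlow Ω r T g) (hΩ : IsOpen Ω) (hT : 0 < T) :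
    ContDiffOn ℝ ∞ (fun p : (Fin n → ℂ) × ℝ => volumeRate g p.1 p.2) (Ω ×ˢ timeInterval T) :=
  (hg.contDiffOn_laplacian hΩ hT (hg.contDiffOn_logDet hΩ hT)).sub contDiffOn_const

theorem hasDerivAt_metric (hg : IsKahlerRicciFlow Ω r T g) (hz : z ∈ Ω) (ht : t ∈ timeInterval T)
    (h0 : 0 < t) (i j : Fin n) : HasDerivAt (fun s => metric g s z i j)
      ((complexHessian (fun w => logDet g w t) z - ((n : ℂ) + 1) • metric g t z) i j) t := by
  refine ((hg.evolution t ht z hz i j).hasDerivAt (timeInterval_mem_nhds ht h0)).congr_deriv ?_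
  simp only [ricci, Matrix.neg_apply, neg_neg, Matrix.sub_apply, Matrix.smul_apply, smul_eq_mul]
  rfl

theorem hasDerivAt_logDet (hg : IsKahlerRicciFlow Ω r T g) (hz : z ∈ Ω) (ht : t ∈ timeInterval T)
    (h0 : 0 < t) : HasDerivAt (fun s => logDet g z s) (volumeRate g z t) t := by
  have hpos := hg.posDef t ht z hz
  refine (hasDerivAt_log_det (hg.hasDerivAt_metric hz ht h0) hpos).congr_deriv ?_
  rw [Matrix.mul_sub, Matrix.mul_smul, Matrix.nonsing_inv_mul _ (isUnit_det hpos),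
    Matrix.trace_sub, Matrix.trace_smul, Matrix.trace_one, Complex.sub_re, volumeRate, laplacian]
  simp
  ring

/-- The differential inequality `∂_t s ≤ Δ_t s - s²/(n+1) - (n+1) s` for `s = ∂_t log det g(t)`. -/
theorem exists_hasDerivAt_volumeRate (hg : IsKahlerRicciFlow Ω r T g) (hΩ : IsOpen Ω) (hT : 0 < T)
    (hz : z ∈ Ω) (ht : t ∈ timeInterval T) (h0 : 0 < t) :
    ∃ d, HasDerivAt (fun s => volumeRate g z s) d t ∧
      d ≤ laplacian (metric g t) (fun w => volumeRate g w t) z -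
        volumeRate g z t ^ 2 / (n + 1) - (n + 1) * volumeRate g z t := by
  have hpos := hg.posDef t ht z hz
  have hL := hg.contDiffOn_logDet hΩ hT
  set Y := complexHessian (fun w => logDet g w t) z - ((n : ℂ) + 1) • metric g t z with hY
  have h1 := hasDerivAt_trace_inv_mul (hg.hasDerivAt_metric hz ht h0)
    (H := fun s => complexHessian (fun w => logDet g w s) z)
    (fun i j => hasDerivAt_complexHessian_slice hΩ (uniqueDiffOn_timeInterval hT) hL hz
      (timeInterval_mem_nhds ht h0) i j) (isUnit_det hpos)
  have h2 := (Complex.reCLM.hasFDerivAt.comp_hasDerivAt t h1).sub_const ((n : ℝ) * (n + 1))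
  refine ⟨_, h2, ?_⟩
  have e1 : complexHessian (fun w => deriv (fun s => logDet g w s) t) z =
      complexHessian (fun w => volumeRate g w t) z := by
    refine complexHessian_congr ?_
    filter_upwards [hΩ.mem_nhds hz] with w hw using (hg.hasDerivAt_logDet hw ht h0).deriv
  have hYh : Y.IsHermitian := by
    refine (complexHessian_isHermitian
      ((contDiffAt_slice hΩ hL hz ht).of_le two_le_infty)).sub (hpos.isHermitian.smul ?_)
    simp [IsSelfAdjoint]
  have hs : volumeRate g z t = ((metric g t z)⁻¹ * Y).trace.re :=
    (hg.hasDerivAt_logDet hz ht h0).unique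
      (hasDerivAt_log_det (hg.hasDerivAt_metric hz ht h0) hpos)
  -- Here `Y = ∂_t g` and `s = tr g⁻¹Y`. Differentiating the inverse metric in `Δ_t log det g`
  -- produces `-tr (g⁻¹Y g⁻¹ ∂∂̄ log det g)`, and substituting `∂∂̄ log det g = Y + (n+1) g` turns
  -- it into `-tr (g⁻¹Y)² - (n+1)s`. Cauchy–Schwarz finishes.
  have e2 : complexHessian (fun w => logDet g w t) z = Y + ((n : ℂ) + 1) • metric g t z := by
    rw [hY, sub_add_cancel]
  have e3 : ((metric g t z)⁻¹ * Y * ((metric g t z)⁻¹ *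
      complexHessian (fun w => logDet g w t) z)).trace.re =
      ((metric g t z)⁻¹ * Y * ((metric g t z)⁻¹ * Y)).trace.re + (n + 1) * volumeRate g z t := by
    rw [e2, Matrix.mul_add, Matrix.mul_smul, Matrix.nonsing_inv_mul _ (isUnit_det hpos),
      Matrix.mul_add, Matrix.mul_smul, Matrix.mul_one, Matrix.trace_add, Matrix.trace_smul,
      Complex.add_re, hs]
    simp
  have h4 := sq_trace_inv_mul_re_le hpos hYh
  rw [← hs] at h4
  simp only [Complex.reCLM_apply, Complex.sub_re]
  rw [e1, e3, laplacian]
  linarith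

end IsKahlerRicciFlow

/-! ### Upper bound for the volume rate by a barrier -/

variable {Ω : Set (Fin n → ℂ)} {r : (Fin n → ℂ) → ℝ} {T : EReal} {g : (Fin n → ℂ) → ℝ → ℝ}

/-- For functions of `φ = -log(-r)`, the Laplacian of `ω(t)` is `p(φ) ↦ p'(φ) a + p''(φ) b` with
bounded nonnegative coefficients `a`, `b`. -/
theorem exists_laplacian_comp_refPotential (hr : IsStrictlyPshDefiningFunction Ω r)
    (hg : IsKahlerRicciFlow Ω r T g) (hq : IsQuasiIsometric Ω r T g) :
    ∃ C : ℝ, 0 ≤ C ∧ ∀ t ∈ timeInterval T, ∀ z ∈ Ω, ∃ a b : ℝ, 0 ≤ a ∧ a ≤ C ∧ 0 ≤ b ∧ b ≤ C ∧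
      ∀ (p p' : ℝ → ℝ) (p'' : ℝ), (∀ᶠ x in 𝓝 (refPotential r z), HasDerivAt p (p' x) x) →
        HasDerivAt p' p'' (refPotential r z) →
        laplacian (metric g t) (fun w => p (refPotential r w)) z =
          p' (refPotential r z) * a + p'' * b := by
  obtain ⟨C, hC, hq⟩ := hq
  refine ⟨C * n, by positivity, fun t ht z hz => ?_⟩
  have hpos := hg.posDef t ht z hz
  set φ := refPotential r with hφ
  set V := Matrix.vecMulVec (complexGradient φ z) (star (complexGradient φ z)) with hV
  -- The lower bound `ω/C ≤ ω(t)` gives `∂φ ∧ ∂̄φ ≤ ω ≤ C ω(t)`. Taking traces bounds `a = Δ_t φ`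
  -- and `b = |∂φ|²` by `Cn`.
  have h1 : ((C : ℂ) • metric g t z - refMetric r z).PosSemidef := by
    have := (hq t ht z hz).1.smul (α := ℂ) (a := (C : ℂ)) (by rw [Complex.zero_le_real]; exact hC.le)
    rwa [smul_sub, smul_smul, ← Complex.ofReal_mul, mul_one_div_cancel hC.ne', Complex.ofReal_one,
      one_smul] at this
  have h2 : ((C : ℂ) • metric g t z - V).PosSemidef := by
    have := h1.add (hr.refMetric_sub_gradient_posSemidef hz)
    rwa [sub_add_sub_cancel] at this
  have hsm := (hr.contDiffAt_refPotential hz).of_le two_le_infty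
  refine ⟨((metric g t z)⁻¹ * refMetric r z).trace.re, ((metric g t z)⁻¹ * V).trace.re,
    trace_mul_re_nonneg hpos.inv.posSemidef (hr.refMetric_posDef hz).posSemidef,
    trace_inv_mul_re_le hpos h1,
    trace_mul_re_nonneg hpos.inv.posSemidef (Matrix.posSemidef_vecMulVec_self_star _),
    trace_inv_mul_re_le hpos h2, fun p p' p'' hp hp' => ?_⟩
  rw [laplacian, complexHessian_comp hsm hp hp', Matrix.mul_add, Matrix.mul_smul, Matrix.mul_smul,
    Matrix.trace_add, Matrix.trace_smul, Matrix.trace_smul, Complex.add_re, smul_eq_mul, smul_eq_mul,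
    Complex.re_ofReal_mul, Complex.re_ofReal_mul]
  rfl

theorem laplacian_sub {G : (Fin n → ℂ) → Matrix (Fin n) (Fin n) ℂ} {f k : (Fin n → ℂ) → ℝ}
    {z : Fin n → ℂ} (hf : ContDiffAt ℝ 2 f z) (hk : ContDiffAt ℝ 2 k z) :
    laplacian G (fun w => f w - k w) z = laplacian G f z - laplacian G k z := by
  have e : (fun w => f w - k w) = fun w => f w + (-1 : ℝ) * k w := by funext w; ring
  rw [e, laplacian, complexHessian_add hf (contDiffAt_const.mul hk), complexHessian_const_mul _ hk,
    Matrix.mul_add, Matrix.mul_smul, Matrix.trace_add, Matrix.trace_smul, Complex.add_re,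
    smul_eq_mul, Complex.re_ofReal_mul, laplacian, laplacian]
  ring

theorem volumeRate_zero_le (hr : IsStrictlyPshDefiningFunction Ω r)
    (hg : IsKahlerRicciFlow Ω r T g) : ∃ A : ℝ, ∀ z ∈ Ω, volumeRate g z 0 ≤ A := by
  obtain ⟨A, hA⟩ := hr.exists_laplacian_log_det_le
  refine ⟨A, fun z hz => ?_⟩
  have e : complexHessian (fun w => logDet g w 0) z =
      complexHessian (fun w => Real.log (refMetric r w).det.re) z := by
    refine complexHessian_congr ?_
    filter_upwards [hr.isOpen.mem_nhds hz] with w hw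
    rw [logDet, hg.initial w hw]
  have := hA z hz
  rw [laplacian] at this
  rw [volumeRate, laplacian, e, hg.initial z hz]
  have h2 : (0 : ℝ) ≤ n * (n + 1) := by positivity
  linarith

/-- Only earlier times are compared, because a maximum over a closed time interval may sit at its
right endpoint. -/
theorem nonneg_of_hasDerivAt_of_eventually_le {u : ℝ → ℝ} {d t : ℝ} (hu : HasDerivAt u d t)
    (h : ∀ᶠ s in 𝓝[<] t, u s ≤ u t) : 0 ≤ d := by
  have h1 : Tendsto (slope u t) (𝓝[<] t) (𝓝 d) :=
    (hasDerivAt_iff_tendsto_slope.1 hu).mono_left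
      (nhdsWithin_mono t fun s (hs : s ∈ Iio t) => ne_of_lt hs)
  refine ge_of_tendsto h1 ?_
  filter_upwards [h, self_mem_nhdsWithin] with s hs1 hs2
  rw [slope_def_field]
  exact div_nonneg_of_nonpos (by linarith) (by linarith [mem_Iio.1 hs2])

/-- The arithmetic behind the barrier `A + M q²`, `q = 1/(R - φ)`. -/
theorem not_sq_div_le {C A M q a b N : ℝ} (hC : 0 ≤ C) (hN : 0 < N) (hA : C * N + 1 ≤ A)
    (hM : 7 * C * N + 1 ≤ M) (hq : 0 < q) (ha : a ≤ C) (hb : b ≤ C) :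
    ¬ (A + M * q ^ 2) ^ 2 / N ≤ 2 * M * q ^ 3 * a + 6 * M * q ^ 4 * b := by
  intro h
  have hCN : 0 ≤ C * N := by positivity
  have hApos : 0 < A := by linarith
  have hMpos : 0 < M := by linarith
  rw [div_le_iff₀ hN] at h
  have h2 : 2 * M * q ^ 3 * a ≤ 2 * M * q ^ 3 * C := by gcongr
  have h3 : 6 * M * q ^ 4 * b ≤ 6 * M * q ^ 4 * C := by gcongr
  -- The inequality `2q³ ≤ q² + q⁴` splits the cubic term. In the expanded square, `2AMq²` absorbs
  -- the `q²` part since `A ≥ CN`, and `M²q⁴` absorbs the `q⁴` part since `M ≥ 7CN`, where `7 = 1 +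
  -- 6`. The term `A²` remains and makes the contradiction strict.
  have h4 : 2 * M * q ^ 3 * C ≤ M * (q ^ 2 + q ^ 4) * C := by
    have h41 : 2 * q ^ 3 ≤ q ^ 2 + q ^ 4 := by
      have := sq_nonneg (q - q ^ 2)
      ring_nf at this ⊢
      linarith
    have h42 := mul_le_mul_of_nonneg_right (mul_le_mul_of_nonneg_left h41 hMpos.le) hC
    linarith
  have h5 : (A + M * q ^ 2) ^ 2 ≤ (M * (q ^ 2 + q ^ 4) * C + 6 * M * q ^ 4 * C) * N :=
    h.trans (mul_le_mul_of_nonneg_right (by linarith) hN.le)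
  have h6 : M * q ^ 2 * (C * N) ≤ M * q ^ 2 * A :=
    mul_le_mul_of_nonneg_left (by linarith) (by positivity)
  have h7 : M * q ^ 4 * (7 * C * N) ≤ M * q ^ 4 * M :=
    mul_le_mul_of_nonneg_left (by linarith) (by positivity)
  have h8 : 0 < A ^ 2 := by positivity
  have h9 : 0 ≤ M * q ^ 2 * A := by positivity
  ring_nf at h5 h6 h7 h8 h9
  linarith

/-- The volume density grows at a uniformly bounded rate: the scalar curvature of `ω(t)` is bounded
below on `Ω × [0, T)`. -/
theorem exists_volumeRate_le (hr : IsStrictlyPshDefiningFunction Ω r) (hT : 0 < T)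
    (hg : IsKahlerRicciFlow Ω r T g) (hq : IsQuasiIsometric Ω r T g) :
    ∃ A : ℝ, 0 ≤ A ∧ ∀ t ∈ timeInterval T, ∀ z ∈ Ω, volumeRate g z t ≤ A := by
  obtain ⟨A₀, hA₀⟩ := volumeRate_zero_le hr hg
  obtain ⟨C, hC0, hC⟩ := exists_laplacian_comp_refPotential hr hg hq
  -- `A` dominates the initial values, and `A`, `B` are the thresholds of `not_sq_div_le` with `N =
  -- n + 1`. Neither depends on the `R` below.
  set A := max A₀ (C * (n + 1) + 1) with hA
  set B := 7 * C * (n + 1) + 1 with hB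
  have hn : (0 : ℝ) < n + 1 := by positivity
  have hA1 : C * (n + 1) + 1 ≤ A := le_max_right _ _
  have hApos : 0 < A := by have : 0 ≤ C * ((n : ℝ) + 1) := by positivity
                           linarith
  have hBpos : 0 < B := by positivity
  have hs := hg.contDiffOn_volumeRate hr.isOpen hT
  have key : ∀ R : ℝ, ∀ t₀ ∈ timeInterval T, ∀ z ∈ Ω, refPotential r z ≤ R →
      (R - refPotential r z) ^ 2 * (volumeRate g z t₀ - A) ≤ B := by
    intro R t₀ ht₀ z₀ hz₀ hzR
    by_contra! hcon
    set K := {z ∈ Ω | refPotential r z ≤ R} with hK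
    have hKΩ : K ⊆ Ω := fun z hz => hz.1
    have hφc : ContinuousOn (refPotential r) Ω := continuousOn_of_forall_continuousAt fun z hz =>
      (hr.contDiffAt_refPotential hz).continuousAt
    have hsub : K ×ˢ Icc 0 t₀ ⊆ Ω ×ˢ timeInterval T :=
      prod_mono hKΩ (Icc_subset_timeInterval ht₀)
    have hcont : ContinuousOn (fun p : (Fin n → ℂ) × ℝ =>
        (R - refPotential r p.1) ^ 2 * (volumeRate g p.1 p.2 - A)) (K ×ˢ Icc 0 t₀) :=
      ((continuousOn_const.sub (hφc.comp continuousOn_fst fun p hp => hKΩ hp.1)).pow 2).mul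
        ((hs.continuousOn.mono hsub).sub continuousOn_const)
    obtain ⟨⟨z, t⟩, ⟨hzK, ht⟩, hmax⟩ := ((hr.isCompact_sublevel R).prod
      isCompact_Icc).exists_isMaxOn ⟨(z₀, t₀), ⟨hz₀, hzR⟩, ⟨ht₀.1, le_rfl⟩⟩ hcont
    have hz := hKΩ hzK
    have htI := Icc_subset_timeInterval ht₀ ht
    -- With `M` the maximal value, the barrier `A + M/(R - φ)²` lies above `s` where `φ < R` and
    -- touches it at `(z, t)`. The assumed failure of the bound says `M > B`.
    set M := (R - refPotential r z) ^ 2 * (volumeRate g z t - A) with hM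
    have hMB : B < M := hcon.trans_le (hmax (a := (z₀, t₀)) ⟨⟨hz₀, hzR⟩, ⟨ht₀.1, le_rfl⟩⟩)
    have hφR : refPotential r z < R := by
      refine lt_of_le_of_ne hzK.2 fun h => ?_
      rw [hM, h] at hMB
      simp at hMB
      linarith
    have hd : 0 < R - refPotential r z := sub_pos.2 hφR
    have hst : volumeRate g z t = A + M / (R - refPotential r z) ^ 2 := by
      rw [hM]; field_simp; ring
    -- At time zero `s ≤ A₀ ≤ A`, which is incompatible with `M > 0`.
    have ht0 : 0 < t := by
      refine lt_of_le_of_ne ht.1 fun h => ?_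
      have h1 : 0 < M / (R - refPotential r z) ^ 2 := div_pos (hBpos.trans hMB) (by positivity)
      have h2 := hA₀ z hz
      rw [← h] at hst
      linarith [le_max_left A₀ (C * (n + 1) + 1)]
    obtain ⟨d, hd1, hd2⟩ := hg.exists_hasDerivAt_volumeRate hr.isOpen hT hz htI ht0
    have hdnn : 0 ≤ d := by
      refine nonneg_of_hasDerivAt_of_eventually_le hd1 ?_
      filter_upwards [self_mem_nhdsWithin, mem_nhdsWithin_of_mem_nhds (lt_mem_nhds ht0)]
        with s hs1 hs0
      have h3 : (R - refPotential r z) ^ 2 * (volumeRate g z s - A) ≤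
          (R - refPotential r z) ^ 2 * (volumeRate g z t - A) :=
        hmax (a := (z, s)) ⟨hzK, ⟨hs0.le, (le_of_lt hs1).trans ht.2⟩⟩
      have h4 := le_of_mul_le_mul_left h3 (by positivity : 0 < (R - refPotential r z) ^ 2)
      linarith
    obtain ⟨a, b, ha0, haC, hb0, hbC, hlap⟩ := hC t htI z hz
    set q := (R - refPotential r z)⁻¹ with hq
    have hqpos : 0 < q := inv_pos.2 hd
    have hbar : laplacian (metric g t) (fun w => A + M / (R - refPotential r w) ^ 2) z =
        2 * M * q ^ 3 * a + 6 * M * q ^ 4 * b := by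
      rw [hlap (fun x => A + M / (R - x) ^ 2) (fun x => 2 * M * ((R - x)⁻¹) ^ 3) (6 * M * q ^ 4)]
      · filter_upwards [gt_mem_nhds hφR] with x hx
        have hx' : R - x ≠ 0 := by linarith
        have h1 : HasDerivAt (fun x => R - x) (-1) x := by
          simpa using (hasDerivAt_id x).const_sub R
        refine (((hasDerivAt_const x M).div (h1.pow 2) (pow_ne_zero 2 hx')).const_add A).congr_deriv ?_
        simp
        field_simp
      · have h1 : HasDerivAt (fun x => R - x) (-1) (refPotential r z) := by
          simpa using (hasDerivAt_id (refPotential r z)).const_sub R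
        refine (((h1.inv hd.ne').pow 3).const_mul (2 * M)).congr_deriv ?_
        simp [hq]
        field_simp
        ring
    have hφs := hr.contDiffAt_refPotential hz
    have hbs : ContDiffAt ℝ ∞ (fun w => A + M / (R - refPotential r w) ^ 2) z :=
      contDiffAt_const.add (contDiffAt_const.div ((contDiffAt_const.sub hφs).pow 2)
        (pow_ne_zero 2 hd.ne'))
    have hss := contDiffAt_slice hr.isOpen hs hz htI
    have hlm : IsLocalMax (fun w => volumeRate g w t - (A + M / (R - refPotential r w) ^ 2)) z := by
      have h1 : ∀ᶠ w in 𝓝 z, refPotential r w < R := hφs.continuousAt.eventually (gt_mem_nhds hφR)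
      filter_upwards [h1, hr.isOpen.mem_nhds hz] with w hw1 hw2
      have h2 : (R - refPotential r w) ^ 2 * (volumeRate g w t - A) ≤ M :=
        hmax (a := (w, t)) ⟨⟨hw2, hw1.le⟩, ht⟩
      have h3 : volumeRate g w t - A ≤ M / (R - refPotential r w) ^ 2 := by
        rw [le_div_iff₀ (by have := sub_pos.2 hw1; positivity), mul_comm]
        exact h2
      rw [← hst]
      linarith
    have hle := laplacian_nonpos_of_isLocalMax (hg.posDef t htI z hz)
      ((hss.sub hbs).of_le two_le_infty) hlm
    rw [laplacian_sub (hss.of_le two_le_infty) (hbs.of_le two_le_infty), hbar] at hle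
    have hst' : volumeRate g z t = A + M * q ^ 2 := by rw [hst, hq]; field_simp
    have hMpos : 0 < M := hBpos.trans hMB
    have hMq : 0 ≤ M * q ^ 2 := by positivity
    have hspos : 0 ≤ (n + 1) * volumeRate g z t := by rw [hst']; positivity
    -- At the maximum `0 ≤ ∂_t s` and `Δ_t s` is at most the Laplacian of the barrier; the term
    -- `-(n+1)s` is dropped because `s ≥ 0` there.
    have h1 : volumeRate g z t ^ 2 / (n + 1) ≤ 2 * M * q ^ 3 * a + 6 * M * q ^ 4 * b := by linarith
    rw [hst'] at h1
    exact not_sq_div_le hC0 hn hA1 hMB.le hqpos haC hbC h1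
  refine ⟨A, hApos.le, fun t ht z hz => ?_⟩
  by_contra! hcon
  set δ := volumeRate g z t - A with hδ
  have hδpos : 0 < δ := sub_pos.2 hcon
  -- For `R = φ(z) + k + 1` the local bound reads `(k+1)² δ ≤ B`, which fails for large `k`.
  obtain ⟨k, hk⟩ := exists_nat_gt (B / δ)
  have hk1 : B < k * δ := by rwa [div_lt_iff₀ hδpos] at hk
  have h1 := key (refPotential r z + (k + 1)) t ht z hz (by
    have : (0 : ℝ) ≤ k := Nat.cast_nonneg k
    linarith)
  rw [add_sub_cancel_left] at h1
  have h2 : (0 : ℝ) ≤ k := Nat.cast_nonneg k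
  nlinarith [mul_nonneg h2 hδpos.le, mul_nonneg (mul_nonneg h2 h2) hδpos.le]

/-! ### The penalty function and the exponential cutoffs -/

section Cutoff

theorem hasDerivAt_max_zero_pow (k : ℕ) (x : ℝ) :
    HasDerivAt (fun x : ℝ => max x 0 ^ (k + 2)) ((k + 2) * max x 0 ^ (k + 1)) x := by
  rcases lt_trichotomy x 0 with hx | rfl | hx
  · have e : (fun x : ℝ => max x 0 ^ (k + 2)) =ᶠ[𝓝 x] fun _ => 0 := by
      filter_upwards [gt_mem_nhds hx] with y hy
      rw [max_eq_right hy.le, zero_pow (by omega)]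
    refine ((hasDerivAt_const x (0 : ℝ)).congr_of_eventuallyEq e).congr_deriv ?_
    rw [max_eq_right hx.le, zero_pow (by omega), mul_zero]
  · rw [hasDerivAt_iff_isLittleO]
    have h1 : (fun x : ℝ => max x 0 ^ (k + 2)) =O[𝓝 0] fun x : ℝ => x ^ (k + 2) := by
      refine Asymptotics.IsBigO.of_bound 1 (Eventually.of_forall fun x => ?_)
      rw [one_mul, norm_pow, norm_pow]
      refine pow_le_pow_left₀ (norm_nonneg _) ?_ _
      rw [Real.norm_eq_abs, Real.norm_eq_abs, abs_of_nonneg (le_max_right _ _)]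
      exact max_le (le_abs_self x) (abs_nonneg x)
    have h2 : (fun x : ℝ => x ^ (k + 2)) =o[𝓝 0] fun x : ℝ => x := by
      simpa using Asymptotics.isLittleO_pow_pow (𝕜 := ℝ) (m := 1) (n := k + 2) (by omega)
    simpa using h1.trans_isLittleO h2
  · have e : (fun x : ℝ => max x 0 ^ (k + 2)) =ᶠ[𝓝 x] fun x => x ^ (k + 2) := by
      filter_upwards [lt_mem_nhds hx] with y hy
      rw [max_eq_left hy.le]
    refine ((hasDerivAt_pow (k + 2) x).congr_of_eventuallyEq e).congr_deriv ?_
    rw [max_eq_left hx.le]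
    push_cast
    rfl

theorem contDiff_max_zero_pow (k : ℕ) : ContDiff ℝ k (fun x : ℝ => max x 0 ^ (k + 1)) := by
  induction k with
  | zero =>
    simp only [Nat.cast_zero, zero_add, pow_one]
    exact contDiff_zero.2 (continuous_id.max continuous_const)
  | succ k ih =>
    have h : deriv (fun x : ℝ => max x 0 ^ (k + 1 + 1)) =
        fun x => ((k : ℝ) + 2) * max x 0 ^ (k + 1) :=
      funext fun x => (hasDerivAt_max_zero_pow k x).deriv
    push_cast
    rw [contDiff_succ_iff_deriv]
    refine ⟨fun x => (hasDerivAt_max_zero_pow k x).differentiableAt, by simp, ?_⟩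
    rw [h]
    exact contDiff_const.mul ih

/-- A `C²` convex nonincreasing function, zero on `[0, ∞)` and positive on `(-∞, 0)`, bounded by
the square of the negative part. -/
def negPenalty (x : ℝ) : ℝ := √(1 + max (-x) 0 ^ 4) - 1

def negPenaltyDeriv (x : ℝ) : ℝ := -2 * max (-x) 0 ^ 3 / √(1 + max (-x) 0 ^ 4)

theorem hasDerivAt_max_neg_zero_pow (k : ℕ) (x : ℝ) :
    HasDerivAt (fun x : ℝ => max (-x) 0 ^ (k + 2)) (-((k + 2) * max (-x) 0 ^ (k + 1))) x := by
  refine ((hasDerivAt_max_zero_pow k (-x)).comp x (hasDerivAt_neg x)).congr_deriv ?_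
  ring

theorem one_add_max_pow_pos (x : ℝ) : 0 < 1 + max (-x) 0 ^ 4 := by positivity

theorem contDiff_negPenalty : ContDiff ℝ 2 negPenalty := by
  have h : ContDiff ℝ 2 (fun x : ℝ => max (-x) 0 ^ 4) :=
    ((contDiff_max_zero_pow 3).comp contDiff_neg).of_le (by norm_num)
  exact ((contDiff_const.add h).sqrt fun x => (one_add_max_pow_pos x).ne').sub contDiff_const

theorem hasDerivAt_negPenalty (x : ℝ) : HasDerivAt negPenalty (negPenaltyDeriv x) x := by
  refine ((((hasDerivAt_max_neg_zero_pow 2 x).const_add 1).sqrt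
    (one_add_max_pow_pos x).ne').sub_const 1).congr_deriv ?_
  have := Real.sqrt_pos.2 (one_add_max_pow_pos x)
  rw [negPenaltyDeriv]
  push_cast
  field_simp
  ring

theorem exists_hasDerivAt_negPenaltyDeriv (x : ℝ) :
    ∃ d, 0 ≤ d ∧ HasDerivAt negPenaltyDeriv d x := by
  have hs := Real.sqrt_pos.2 (one_add_max_pow_pos x)
  have h1 := (((hasDerivAt_max_neg_zero_pow 1 x).const_mul (-2)).div
    (((hasDerivAt_max_neg_zero_pow 2 x).const_add 1).sqrt (one_add_max_pow_pos x).ne') hs.ne')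
  refine ⟨_, ?_, h1⟩
  refine div_nonneg ?_ (by positivity)
  set m := max (-x) 0 with hm
  have hm0 : 0 ≤ m := le_max_right _ _
  simp only [Nat.reduceAdd] at hs ⊢
  set q := √(1 + m ^ 4) with hq
  have hq2 : q ^ 2 = 1 + m ^ 4 := Real.sq_sqrt (one_add_max_pow_pos x).le
  -- Convexity comes down to `6m²(1 + m⁴) - 4m⁶ = 6m² + 2m⁶ ≥ 0`.
  have e : -2 * -(((1 : ℕ) + 2 : ℝ) * m ^ 2) * q -
      -2 * m ^ 3 * (-(((2 : ℕ) + 2 : ℝ) * m ^ 3) / (2 * q)) = (6 * m ^ 2 + 2 * m ^ 6) / q := by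
    push_cast
    field_simp
    rw [hq2]
    ring
  rw [e]
  positivity

theorem negPenaltyDeriv_nonpos (x : ℝ) : negPenaltyDeriv x ≤ 0 := by
  refine div_nonpos_of_nonpos_of_nonneg ?_ (Real.sqrt_nonneg _)
  have : 0 ≤ max (-x) 0 ^ 3 := by positivity
  linarith

theorem negPenaltyDeriv_of_nonneg {x : ℝ} (hx : 0 ≤ x) : negPenaltyDeriv x = 0 := by
  simp [negPenaltyDeriv, max_eq_right (neg_nonpos.2 hx)]

theorem negPenalty_of_nonneg {x : ℝ} (hx : 0 ≤ x) : negPenalty x = 0 := by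
  simp [negPenalty, max_eq_right (neg_nonpos.2 hx)]

theorem negPenalty_nonneg (x : ℝ) : 0 ≤ negPenalty x := by
  have h : 1 ≤ √(1 + max (-x) 0 ^ 4) := Real.one_le_sqrt.2 (by
    have : 0 ≤ max (-x) 0 ^ 4 := by positivity
    linarith)
  exact sub_nonneg.2 h

theorem negPenalty_pos {x : ℝ} (hx : x < 0) : 0 < negPenalty x := by
  have h : 1 < √(1 + max (-x) 0 ^ 4) := by
    rw [Real.lt_sqrt zero_le_one, max_eq_left (by linarith)]
    have : 0 < (-x) ^ 4 := by have := neg_pos.2 hx; positivity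
    linarith
  exact sub_pos.2 h

/-- This explains the choice of penalty. The square of the negative part is not `C²` at `0`; the
fourth power smooths the contact there, and the root restores quadratic growth, so the growth
hypothesis still controls it through `√(1 + m⁴) ≤ 1 + m²`. -/
theorem negPenalty_le (x : ℝ) : negPenalty x ≤ (-min x 0) ^ 2 := by
  have e : -min x 0 = max (-x) 0 := by rw [← max_neg_neg, neg_zero]
  rw [e, negPenalty, sub_le_iff_le_add]
  refine Real.sqrt_le_iff.2 ⟨by positivity, ?_⟩
  have : 0 ≤ max (-x) 0 ^ 2 := by positivity
  nlinarith

/-- The cutoff `((e^{-ax} - ε)₊)³` of `e^{-3ax}`. -/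
def expCutoff (a ε x : ℝ) : ℝ := max (Real.exp (-a * x) - ε) 0 ^ 3

def expCutoffDeriv (a ε x : ℝ) : ℝ :=
  -3 * a * Real.exp (-a * x) * max (Real.exp (-a * x) - ε) 0 ^ 2

variable {a ε x : ℝ}

theorem hasDerivAt_exp_neg_mul_sub (a ε x : ℝ) :
    HasDerivAt (fun x => Real.exp (-a * x) - ε) (-a * Real.exp (-a * x)) x := by
  refine ((((hasDerivAt_id x).const_mul (-a)).exp).sub_const ε).congr_deriv ?_
  simp
  ring

theorem contDiff_expCutoff (a ε : ℝ) : ContDiff ℝ 2 (expCutoff a ε) :=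
  (contDiff_max_zero_pow 2).comp (((contDiff_const.mul contDiff_id).exp).sub contDiff_const)

theorem hasDerivAt_expCutoff (a ε x : ℝ) :
    HasDerivAt (expCutoff a ε) (expCutoffDeriv a ε x) x := by
  refine ((hasDerivAt_max_zero_pow 1 _).comp x (hasDerivAt_exp_neg_mul_sub a ε x)).congr_deriv ?_
  rw [expCutoffDeriv]
  push_cast
  ring

theorem expCutoffDeriv_nonpos (ha : 0 ≤ a) (ε x : ℝ) : expCutoffDeriv a ε x ≤ 0 := by
  have : 0 ≤ a * Real.exp (-a * x) * max (Real.exp (-a * x) - ε) 0 ^ 2 := by positivity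
  rw [expCutoffDeriv]
  linarith

theorem hasDerivAt_expCutoffDeriv (a ε x : ℝ) :
    HasDerivAt (expCutoffDeriv a ε) (3 * a ^ 2 * Real.exp (-a * x) *
      (max (Real.exp (-a * x) - ε) 0 ^ 2 +
        2 * Real.exp (-a * x) * max (Real.exp (-a * x) - ε) 0)) x := by
  have h1 : HasDerivAt (fun x => -3 * a * Real.exp (-a * x)) (3 * a ^ 2 * Real.exp (-a * x)) x := by
    refine (((hasDerivAt_id x).const_mul (-a)).exp.const_mul (-3 * a)).congr_deriv ?_
    simp
    ring
  have h2 := (hasDerivAt_max_zero_pow 0 _).comp x (hasDerivAt_exp_neg_mul_sub a ε x)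
  refine (h1.mul h2).congr_deriv ?_
  simp
  ring

theorem expCutoff_nonneg (a ε x : ℝ) : 0 ≤ expCutoff a ε x := by
  rw [expCutoff]; positivity

theorem max_exp_sub_le (hε : 0 ≤ ε) : max (Real.exp (-a * x) - ε) 0 ≤ Real.exp (-a * x) :=
  max_le (by linarith) (Real.exp_pos _).le

theorem expCutoff_le (hε : 0 ≤ ε) : expCutoff a ε x ≤ Real.exp (-a * x) ^ 3 :=
  pow_le_pow_left₀ (le_max_right _ _) (max_exp_sub_le hε) 3

/-- The bound is by the full weight `e^{-3ax}` and not by the cutoff, which vanishes to higher order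
than its second derivative at the edge of its support. The constant does not depend on `ε`. -/
theorem expCutoff_second_le (hε : 0 ≤ ε) : 3 * a ^ 2 * Real.exp (-a * x) *
      (max (Real.exp (-a * x) - ε) 0 ^ 2 +
        2 * Real.exp (-a * x) * max (Real.exp (-a * x) - ε) 0) ≤
      9 * a ^ 2 * Real.exp (-a * x) ^ 3 := by
  have h1 := max_exp_sub_le (a := a) (x := x) hε
  have h2 := Real.exp_pos (-a * x)
  have h3 := pow_le_pow_left₀ (le_max_right (Real.exp (-a * x) - ε) 0) h1 2
  have h4 := mul_le_mul_of_nonneg_left h1 h2.le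
  calc _ ≤ 3 * a ^ 2 * Real.exp (-a * x) * (3 * Real.exp (-a * x) ^ 2) :=
        mul_le_mul_of_nonneg_left (by nlinarith) (by positivity)
    _ = _ := by ring

theorem expCutoff_eq_zero (ha : 0 < a) (hε : 0 < ε) (hx : -Real.log ε / a < x) :
    expCutoff a ε x = 0 := by
  have h : Real.exp (-a * x) ≤ ε := by
    rw [div_lt_iff₀ ha] at hx
    rw [← Real.exp_log hε]
    exact Real.exp_le_exp.2 (by linarith)
  rw [expCutoff, max_eq_right (by linarith)]
  norm_num

theorem tendsto_expCutoff (a x : ℝ) :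
    Tendsto (fun k : ℕ => expCutoff a (1 / ((k : ℝ) + 1)) x) atTop (𝓝 (Real.exp (-a * x) ^ 3)) := by
  have h1 : Tendsto (fun ε : ℝ => expCutoff a ε x) (𝓝 0) (𝓝 (expCutoff a 0 x)) := by
    have : Continuous fun ε : ℝ => expCutoff a ε x := by
      unfold expCutoff
      fun_prop
    exact this.tendsto 0
  have e : expCutoff a 0 x = Real.exp (-a * x) ^ 3 := by
    rw [expCutoff, sub_zero, max_eq_left (Real.exp_pos _).le]
  rw [e] at h1
  exact h1.comp tendsto_one_div_add_atTop_nhds_zero_nat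

end Cutoff

/-! ### Grönwall's lemma and the weighted energy inequality -/

open scoped ENNReal in
/-- Grönwall's lemma for integrable functions with values in `[0, ∞]`. -/
theorem lintegral_Ioc_eq_zero_of_le_lintegral {E : ℝ → ℝ≥0∞} {c : NNReal} {t : ℝ} (ht : 0 ≤ t)
    (hE : ∀ s ∈ Icc 0 t, E s ≤ c * ∫⁻ x in Ioc 0 s, E x) (hfin : ∫⁻ x in Ioc 0 t, E x < ⊤) :
    ∫⁻ x in Ioc 0 t, E x = 0 := by
  -- This step length gives `cτ ≤ 1/2`. If the integral vanishes up to some time, then over the next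
  -- `τ` it is at most half of itself, hence zero by finiteness. `E` is not assumed measurable, so
  -- the splitting uses only subadditivity.
  set τ : ℝ := 1 / (2 * (c + 1)) with hτ
  have hτpos : 0 < τ := by positivity
  have hcτ : (c : ℝ≥0∞) * ENNReal.ofReal τ ≤ 2⁻¹ := by
    rw [← ENNReal.ofReal_coe_nnreal, ← ENNReal.ofReal_mul c.coe_nonneg]
    have : (2⁻¹ : ℝ≥0∞) = ENNReal.ofReal 2⁻¹ := by
      rw [ENNReal.ofReal_inv_of_pos (by norm_num)]; simp
    rw [this]
    refine ENNReal.ofReal_le_ofReal ?_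
    rw [hτ]
    have := c.coe_nonneg
    rw [mul_one_div, div_le_iff₀ (by positivity)]
    linarith
  have step : ∀ k : ℕ, ∫⁻ x in Ioc 0 (min (k * τ) t), E x = 0 := by
    intro k
    induction k with
    | zero => simp [ht]
    | succ k ih =>
      set u := min (k * τ) t with hu
      set w := min ((k + 1 : ℕ) * τ) t with hw
      have hu0 : 0 ≤ u := le_min (by positivity) ht
      have huw : u ≤ w := min_le_min_right _ (by push_cast; nlinarith)
      have hwt : w ≤ t := min_le_right _ _
      have hwu : w - u ≤ τ := by
        have : w ≤ u + τ := by
          rcases le_total (k * τ) t with h | h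
          · rw [hu, min_eq_left h]
            exact (min_le_left _ _).trans (by push_cast; linarith)
          · rw [hu, min_eq_right h]
            linarith
        linarith
      set J := ∫⁻ x in Ioc 0 w, E x with hJ
      have hJfin : J ≠ ⊤ := ((lintegral_mono_set (Ioc_subset_Ioc_right hwt)).trans_lt hfin).ne
      have h1 : J ≤ ∫⁻ x in Ioc u w, E x := by
        rw [hJ, ← Ioc_union_Ioc_eq_Ioc hu0 huw]
        refine (lintegral_union_le _ _ _).trans ?_
        rw [ih, zero_add]
      have h2 : ∫⁻ x in Ioc u w, E x ≤ ∫⁻ x in Ioc u w, c * J := by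
        refine setLIntegral_mono' measurableSet_Ioc fun x hx => ?_
        exact (hE x ⟨hu0.trans hx.1.le, hx.2.trans hwt⟩).trans
          (mul_le_mul_right (lintegral_mono_set (Ioc_subset_Ioc_right hx.2)) _)
      have h3 : J ≤ 2⁻¹ * J := by
        refine (h1.trans h2).trans ?_
        rw [lintegral_const, Measure.restrict_apply MeasurableSet.univ, univ_inter, Real.volume_Ioc]
        calc (c : ℝ≥0∞) * J * ENNReal.ofReal (w - u) ≤ c * J * ENNReal.ofReal τ :=
              mul_le_mul_right (ENNReal.ofReal_le_ofReal hwu) _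
          _ = c * ENNReal.ofReal τ * J := by ring
          _ ≤ 2⁻¹ * J := mul_le_mul_left hcτ _
      by_contra hne
      have h4 : 2⁻¹ * J < J := by
        rw [mul_comm, ← div_eq_mul_inv]
        exact ENNReal.half_lt_self hne hJfin
      exact absurd h3 (not_le.2 h4)
  obtain ⟨k, hk⟩ := exists_nat_gt (t / τ)
  have h := step k
  rwa [min_eq_right ((div_lt_iff₀ hτpos).1 hk).le] at h

/-- Integrability need not be checked: the Bochner integral of a non-integrable function is `0` by
default. -/
theorem ofReal_integral_le_lintegral {α : Type*} [MeasurableSpace α] (μ : Measure α) (F : α → ℝ) :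
    ENNReal.ofReal (∫ x, F x ∂μ) ≤ ∫⁻ x, ENNReal.ofReal (F x) ∂μ := by
  by_cases hF : Integrable F μ
  · rw [integral_eq_lintegral_pos_part_sub_lintegral_neg_part hF]
    exact (ENNReal.ofReal_le_ofReal (sub_le_self _ ENNReal.toReal_nonneg)).trans
      ENNReal.ofReal_toReal_le
  · rw [integral_undef hF]
    simp

theorem laplacian_eq_zero_of_eventuallyEq_zero {G : (Fin n → ℂ) → Matrix (Fin n) (Fin n) ℂ}
    {f : (Fin n → ℂ) → ℝ} {z : Fin n → ℂ} (h : f =ᶠ[𝓝 z] fun _ => 0) : laplacian G f z = 0 := by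
  have e : complexHessian f z = 0 := by
    rw [complexHessian_congr (h.trans (Eventually.of_forall fun w => (zero_mul (0 : ℝ)).symm)),
      complexHessian_const_mul (f := fun _ => (0 : ℝ)) 0 contDiffAt_const]
    simp
  simp [laplacian, e]

variable {Ω : Set (Fin n → ℂ)} {r : (Fin n → ℂ) → ℝ} {T : EReal} {g f : (Fin n → ℂ) → ℝ → ℝ}

/-- The penalty is nonincreasing, which reverses the supersolution inequality, and convex, which
gives the gradient term a favourable sign. For `f ≥ 0` its derivative is zero, so the inequality for
`f` is needed only where `f ≤ 0`. -/
theorem exists_hasDerivAt_negPenalty_le (hΩ : IsOpen Ω) (hg : IsKahlerRicciFlow Ω r T g)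
    (hf : ContDiffOn ℝ ∞ (fun p : (Fin n → ℂ) × ℝ => f p.1 p.2) (Ω ×ˢ timeInterval T))
    (hsuper : ∀ t ∈ timeInterval T, ∀ z ∈ Ω, f z t ≤ 0 →
      0 ≤ derivWithin (fun s => f z s) (timeInterval T) t -
        laplacian (metric g t) (fun w => f w t) z)
    {t : ℝ} (ht : t ∈ timeInterval T) (h0 : 0 < t) {z : Fin n → ℂ} (hz : z ∈ Ω) :
    ∃ d, HasDerivAt (fun s => negPenalty (f z s)) d t ∧
      d ≤ laplacian (metric g t) (fun w => negPenalty (f w t)) z := by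
  have hI := timeInterval_mem_nhds ht h0
  have hpos := hg.posDef t ht z hz
  have h1 := hasDerivAt_slice hΩ hf hz hI
  refine ⟨_, (hasDerivAt_negPenalty (f z t)).comp t h1, ?_⟩
  obtain ⟨c, hc, hd⟩ := exists_hasDerivAt_negPenaltyDeriv (f z t)
  have hsm := (contDiffAt_slice hΩ hf hz ht).of_le two_le_infty
  have e : laplacian (metric g t) (fun w => negPenalty (f w t)) z =
      negPenaltyDeriv (f z t) * laplacian (metric g t) (fun w => f w t) z +
        c * ((metric g t z)⁻¹ * Matrix.vecMulVec (complexGradient (fun w => f w t) z)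
          (star (complexGradient (fun w => f w t) z))).trace.re := by
    rw [laplacian, complexHessian_comp (f := fun w => f w t) hsm
      (Eventually.of_forall hasDerivAt_negPenalty) hd, Matrix.mul_add, Matrix.mul_smul,
      Matrix.mul_smul, Matrix.trace_add, Matrix.trace_smul, Matrix.trace_smul, Complex.add_re,
      smul_eq_mul, smul_eq_mul, Complex.re_ofReal_mul, Complex.re_ofReal_mul, laplacian]
  have h2 := mul_nonneg hc (trace_mul_re_nonneg hpos.inv.posSemidef
    (Matrix.posSemidef_vecMulVec_self_star (complexGradient (fun w => f w t) z)))
  rw [e]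
  rcases le_total (f z t) 0 with hft | hft
  · have h3 := hsuper t ht z hz hft
    rw [derivWithin_of_mem_nhds hI, h1.deriv, sub_nonneg] at h3
    have h4 := mul_le_mul_of_nonpos_left h3 (negPenaltyDeriv_nonpos (f z t))
    linarith
  · rw [negPenaltyDeriv_of_nonneg hft, zero_mul, zero_mul]
    linarith

theorem hasDerivAt_det_metric (hg : IsKahlerRicciFlow Ω r T g) {t : ℝ} (ht : t ∈ timeInterval T)
    (h0 : 0 < t) {z : Fin n → ℂ} (hz : z ∈ Ω) :
    HasDerivAt (fun s => (metric g s z).det.re)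
      ((metric g t z).det.re * volumeRate g z t) t := by
  have h := (hg.hasDerivAt_logDet hz ht h0).exp
  have e : ∀ s ∈ timeInterval T, Real.exp (logDet g z s) = (metric g s z).det.re := fun s hs =>
    Real.exp_log (det_re_pos (hg.posDef s hs z hz))
  rw [e t ht] at h
  refine h.congr_of_eventuallyEq ?_
  filter_upwards [timeInterval_mem_nhds ht h0] with s hs using (e s hs).symm

/-- The weighted energy inequality for the negative part of a supersolution. -/
theorem exists_lintegral_expCutoff_le (hr : IsStrictlyPshDefiningFunction Ω r) (hT : 0 < T)
    (hg : IsKahlerRicciFlow Ω r T g) (hq : IsQuasiIsometric Ω r T g)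
    (hf : ContDiffOn ℝ ∞ (fun p : (Fin n → ℂ) × ℝ => f p.1 p.2) (Ω ×ˢ timeInterval T))
    (hsuper : ∀ t ∈ timeInterval T, ∀ z ∈ Ω, f z t ≤ 0 →
      0 ≤ derivWithin (fun s => f z s) (timeInterval T) t -
        laplacian (metric g t) (fun w => f w t) z)
    (hinit : ∀ z ∈ Ω, 0 ≤ f z 0) {a : ℝ} (ha : 0 < a) :
    ∃ c : NNReal, ∀ ε > 0, ∀ t ∈ timeInterval T,
      ∫⁻ z in Ω, ENNReal.ofReal (expCutoff a ε (refPotential r z) *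
        (negPenalty (f z t) * (metric g t z).det.re)) ≤
      c * ∫⁻ s in Ioc 0 t, ∫⁻ z in Ω, ENNReal.ofReal (Real.exp (-a * refPotential r z) ^ 3 *
        (negPenalty (f z s) * (metric g s z).det.re)) := by
  obtain ⟨A, hA0, hA⟩ := exists_volumeRate_le hr hT hg hq
  obtain ⟨C, hC0, hC⟩ := exists_laplacian_comp_refPotential hr hg hq
  -- The first summand bounds the Laplacian of the cutoff, the second the growth of the volume
  -- density; `ε` does not enter.
  set Λ : ℝ := 9 * a ^ 2 * C + A with hΛ
  have hΛ0 : 0 ≤ Λ := by positivity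
  refine ⟨⟨Λ, hΛ0⟩, fun ε hε t ht => ?_⟩
  have hΩ := hr.isOpen
  have hUI := uniqueDiffOn_timeInterval hT
  set I := timeInterval T with hIdef
  -- The cutoff vanishes off this compact set. Integrating over `K` keeps all integrands integrable,
  -- including those with the full weight `y`.
  set K := {z ∈ Ω | refPotential r z ≤ -Real.log ε / a} with hKdef
  have hK : IsCompact K := hr.isCompact_sublevel _
  have hKΩ : K ⊆ Ω := fun z hz => hz.1
  have hφ2 : ∀ z ∈ Ω, ContDiffAt ℝ 2 (refPotential r) z := fun z hz =>
    (hr.contDiffAt_refPotential hz).of_le two_le_infty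
  have hφc : ContinuousOn (refPotential r) Ω := continuousOn_of_forall_continuousAt fun z hz =>
    (hφ2 z hz).continuousAt
  set h : (Fin n → ℂ) → ℝ := fun z => expCutoff a ε (refPotential r z) with hh
  set y : (Fin n → ℂ) → ℝ := fun z => Real.exp (-a * refPotential r z) ^ 3 with hy
  set v : (Fin n → ℂ) → ℝ → ℝ := fun z s => negPenalty (f z s) with hv
  set D : (Fin n → ℂ) → ℝ → ℝ := fun z s => (metric g s z).det.re with hD
  have hh2 : ∀ z ∈ Ω, ContDiffAt ℝ 2 h z := fun z hz =>
    (contDiff_expCutoff a ε).contDiffAt.comp z (hφ2 z hz)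
  have hhc : ContinuousOn h Ω := continuousOn_of_forall_continuousAt fun z hz =>
    (hh2 z hz).continuousAt
  have hyc : ContinuousOn y Ω := ((continuousOn_const.mul hφc).rexp).pow 3
  have hh0 : ∀ z ∈ Ω, z ∉ K → h z = 0 := fun z hz hzK =>
    expCutoff_eq_zero ha hε (not_le.1 fun hle => hzK ⟨hz, hle⟩)
  have hv2 : ContDiffOn ℝ 2 (fun p : (Fin n → ℂ) × ℝ => v p.1 p.2) (Ω ×ˢ I) :=
    contDiff_negPenalty.comp_contDiffOn (hf.of_le two_le_infty)
  have hD2 : ContDiffOn ℝ 2 (fun p : (Fin n → ℂ) × ℝ => D p.1 p.2) (Ω ×ˢ I) :=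
    (hg.contDiffOn_det hΩ hT).of_le two_le_infty
  set W : (Fin n → ℂ) × ℝ → ℝ := fun p => v p.1 p.2 * D p.1 p.2 with hW
  have hW2 : ContDiffOn ℝ 2 W (Ω ×ˢ I) := hv2.mul hD2
  -- The derivative within the domain is continuous up to `t = 0`, as the fundamental theorem of
  -- calculus and Fubini require below.
  set W' : (Fin n → ℂ) × ℝ → ℝ := fun p => fderivWithin ℝ W (Ω ×ˢ I) p (0, 1) with hW'
  have hW'c : ContinuousOn W' (Ω ×ˢ I) :=
    (hW2.continuousOn_fderivWithin (hΩ.uniqueDiffOn.prod hUI) (by norm_num)).clm_apply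
      continuousOn_const
  have hWd : ∀ z ∈ Ω, ∀ s ∈ I, 0 < s → HasDerivAt (fun s => W (z, s)) (W' (z, s)) s := by
    intro z hz s hs hs0
    have hmem : Ω ×ˢ I ∈ 𝓝 (z, s) :=
      prod_mem_nhds (hΩ.mem_nhds hz) (timeInterval_mem_nhds hs hs0)
    have h1 : HasFDerivAt W (fderiv ℝ W (z, s)) (z, s) :=
      ((hW2.contDiffAt hmem).differentiableAt (by norm_num)).hasFDerivAt
    have h2 := HasFDerivAt.comp (g := W) (f := fun s : ℝ => (z, s)) s h1
      (hasFDerivAt_prodMk_right (𝕜 := ℝ) z s)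
    refine h2.hasDerivAt.congr_deriv ?_
    simp only [hW', fderivWithin_of_mem_nhds hmem]
    simp
  have hslice : ∀ {F : (Fin n → ℂ) × ℝ → ℝ}, ContinuousOn F (Ω ×ˢ I) → ∀ s ∈ I,
      ContinuousOn (fun z => F (z, s)) Ω := fun hF s hs =>
    hF.comp (f := fun z => (z, s)) (by fun_prop) fun z hz => ⟨hz, hs⟩
  have hDpos : ∀ z ∈ Ω, ∀ s ∈ I, 0 < D z s := fun z hz s hs => det_re_pos (hg.posDef s hs z hz)
  have hWnn : ∀ z ∈ Ω, ∀ s ∈ I, 0 ≤ W (z, s) := fun z hz s hs =>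
    mul_nonneg (negPenalty_nonneg _) (hDpos z hz s hs).le
  have hIcc := Icc_subset_timeInterval ht
  have hKi : ∀ {X : (Fin n → ℂ) → ℝ}, ContinuousOn X Ω → IntegrableOn X K := fun hX =>
    (hX.mono hKΩ).integrableOn_compact hK
  have hKeq : ∀ {X : (Fin n → ℂ) → ℝ}, (∀ z ∈ Ω, z ∉ K → X z = 0) →
      ∫ z in Ω, X z = ∫ z in K, X z := fun hX =>
    setIntegral_eq_of_subset_of_forall_sdiff_eq_zero hΩ.measurableSet hKΩ
      fun z hz => hX z hz.1 hz.2
  -- the spatial estimate at a fixed time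
  have hspace : ∀ s ∈ Ioc 0 t, ∫ z in K, h z * W' (z, s) ≤ Λ * ∫ z in K, y z * W (z, s) := by
    intro s hs
    have hsI : s ∈ I := hIcc ⟨hs.1.le, hs.2⟩
    have hvs : ∀ z ∈ Ω, ContDiffAt ℝ 2 (fun w => v w s) z := fun z hz =>
      contDiffAt_slice hΩ hv2 hz hsI
    have hgs : ∀ z ∈ Ω, ContDiffAt ℝ ∞ (fun w => g w s) z := fun z hz =>
      contDiffAt_slice hΩ hg.smooth hz hsI
    have hG : ∀ z ∈ Ω, ∀ i j, ContDiffWithinAt ℝ 0 (fun w => metric g s w i j) Ω z :=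
      fun z hz i j => ((contDiffAt_complexHessian (m := ∞) (hgs z hz) (by simp) i j).of_le
        (by simp)).contDiffWithinAt
    have hlapc : ∀ {k : (Fin n → ℂ) → ℝ}, (∀ z ∈ Ω, ContDiffAt ℝ 2 k z) →
        ContinuousOn (fun z => laplacian (metric g s) k z) Ω := fun hk z hz =>
      (contDiffWithinAt_trace_inv_mul (hG z hz) (isUnit_det (hg.posDef s hsI z hz)) fun i j =>
        (contDiffAt_complexHessian (m := 0) (hk z hz) (by norm_num) i j).contDiffWithinAt
        ).continuousWithinAt
    have hvc : ContinuousOn (fun z => v z s) Ω := continuousOn_of_forall_continuousAt fun z hz =>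
      (hvs z hz).continuousAt
    have hDc : ContinuousOn (fun z => D z s) Ω := hslice hD2.continuousOn s hsI
    have hWc : ContinuousOn (fun z => W (z, s)) Ω := hvc.mul hDc
    have ibp : ∫ z in Ω, h z * laplacian (metric g s) (fun w => v w s) z * D z s =
        ∫ z in Ω, v z s * laplacian (metric g s) h z * D z s :=
      integral_mul_laplacian_symm hΩ hK hKΩ
        (fun z hz => (hgs z hz).of_le (natCast_le_infty 3)) (hg.posDef s hsI) hh2 hvs hh0
    rw [hKeq fun z hz hzK => by rw [hh0 z hz hzK]; ring, hKeq fun z hz hzK => by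
      rw [laplacian_eq_zero_of_eventuallyEq_zero
        (eventually_eq_zero_off_compact hΩ hK hh0 hz hzK)]; ring] at ibp
    have hi1 : IntegrableOn
        (fun z => h z * laplacian (metric g s) (fun w => v w s) z * D z s) K :=
      hKi ((hhc.mul (hlapc hvs)).mul hDc)
    have hi2 : IntegrableOn (fun z => h z * W (z, s)) K := hKi (hhc.mul hWc)
    have hi3 : IntegrableOn (fun z => v z s * laplacian (metric g s) h z * D z s) K :=
      hKi ((hvc.mul (hlapc hh2)).mul hDc)
    have hi4 : IntegrableOn (fun z => y z * W (z, s)) K := hKi (hyc.mul hWc)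
    calc ∫ z in K, h z * W' (z, s) ≤
          ∫ z in K, (h z * laplacian (metric g s) (fun w => v w s) z * D z s +
            A * (h z * W (z, s))) := by
          refine setIntegral_mono_on (hKi (hhc.mul (hslice hW'c s hsI)))
            (hi1.add (hi2.const_mul A)) hK.measurableSet fun z hzK => ?_
          have hz := hKΩ hzK
          obtain ⟨d, hd, hdle⟩ := exists_hasDerivAt_negPenalty_le hΩ hg hf hsuper hsI hs.1 hz
          have e := (hWd z hz s hsI hs.1).unique (hd.mul (hasDerivAt_det_metric hg hsI hs.1 hz))
          have hhz : 0 ≤ h z := expCutoff_nonneg _ _ _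
          have h1 : d * D z s ≤ laplacian (metric g s) (fun w => v w s) z * D z s :=
            mul_le_mul_of_nonneg_right hdle (hDpos z hz s hsI).le
          have h2 : W (z, s) * volumeRate g z s ≤ W (z, s) * A :=
            mul_le_mul_of_nonneg_left (hA s hsI z hz) (hWnn z hz s hsI)
          have h3 : W' (z, s) ≤ laplacian (metric g s) (fun w => v w s) z * D z s +
              W (z, s) * A := by
            rw [e]
            have : v z s * (D z s * volumeRate g z s) = W (z, s) * volumeRate g z s := by
              simp only [hW]; ring
            linarith
          have h4 := mul_le_mul_of_nonneg_left h3 hhz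
          linarith
      _ = ∫ z in K, (v z s * laplacian (metric g s) h z * D z s + A * (h z * W (z, s))) := by
          rw [integral_add hi1 (hi2.const_mul A), integral_add hi3 (hi2.const_mul A), ibp]
      _ ≤ ∫ z in K, Λ * (y z * W (z, s)) := by
          refine setIntegral_mono_on (hi3.add (hi2.const_mul A)) (hi4.const_mul Λ)
            hK.measurableSet fun z hzK => ?_
          have hz := hKΩ hzK
          obtain ⟨α, β, hα0, -, hβ0, hβC, hlap⟩ := hC s hsI z hz
          have h1 : laplacian (metric g s) h z ≤ 9 * a ^ 2 * C * y z := by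
            rw [hlap _ _ _ (Eventually.of_forall fun x => hasDerivAt_expCutoff a ε x)
              (hasDerivAt_expCutoffDeriv a ε _)]
            -- The first-order term is discarded: the cutoff decreases in `φ` and `Δ_t φ ≥ 0`.
            have h2 := mul_nonpos_of_nonpos_of_nonneg
              (expCutoffDeriv_nonpos ha.le ε (refPotential r z)) hα0
            have h3 := mul_le_mul_of_nonneg_right
              (expCutoff_second_le (a := a) (x := refPotential r z) hε.le) hβ0
            have h4 : 9 * a ^ 2 * y z * β ≤ 9 * a ^ 2 * y z * C :=
              mul_le_mul_of_nonneg_left hβC (by positivity)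
            linarith
          have h2 : h z ≤ y z := expCutoff_le hε.le
          have h3 := mul_le_mul_of_nonneg_right h1 (hWnn z hz s hsI)
          have h4 := mul_le_mul_of_nonneg_left
            (mul_le_mul_of_nonneg_right h2 (hWnn z hz s hsI)) hA0
          have h5 : v z s * laplacian (metric g s) h z * D z s =
              laplacian (metric g s) h z * W (z, s) := by simp only [hW]; ring
          rw [h5, hΛ]
          linarith
      _ = _ := integral_const_mul _ _
  -- the fundamental theorem of calculus and Fubini
  have hftc : ∀ z ∈ Ω, ∫ s in (0 : ℝ)..t, W' (z, s) = W (z, t) := by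
    intro z hz
    have hcW' : ContinuousOn (fun s => W' (z, s)) (Icc 0 t) :=
      hW'c.comp (f := fun s => (z, s)) (by fun_prop) fun s hs => ⟨hz, hIcc hs⟩
    have hcW : ContinuousOn (fun s => W (z, s)) (Icc 0 t) :=
      hW2.continuousOn.comp (f := fun s => (z, s)) (by fun_prop) fun s hs => ⟨hz, hIcc hs⟩
    rw [intervalIntegral.integral_eq_sub_of_hasDerivAt_of_le ht.1 hcW
      (fun s hs => hWd z hz s (hIcc ⟨hs.1.le, hs.2.le⟩) hs.1)
      (by rw [← uIcc_of_le ht.1] at hcW'; exact hcW'.intervalIntegrable)]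
    -- The initial condition enters here: the penalty vanishes where `f ≥ 0`.
    have : W (z, 0) = 0 := by simp [hW, hv, negPenalty_of_nonneg (hinit z hz)]
    rw [this, sub_zero]
  have hfub : ∫ z in K, h z * W (z, t) = ∫ s in Ioc 0 t, ∫ z in K, h z * W' (z, s) := by
    rw [← intervalIntegral.integral_of_le ht.1, intervalIntegral_integral_swap]
    · refine setIntegral_congr_fun hK.measurableSet fun z hz => ?_
      rw [intervalIntegral.integral_const_mul, hftc z (hKΩ hz)]
    · rw [Measure.prod_restrict, uIoc_of_le ht.1]
      have hc : ContinuousOn (Function.uncurry fun (s : ℝ) (z : Fin n → ℂ) => h z * W' (z, s))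
          (Icc 0 t ×ˢ K) :=
        (hhc.comp continuousOn_snd fun p hp => hKΩ hp.2).mul
          (hW'c.comp (f := fun p : ℝ × (Fin n → ℂ) => (p.2, p.1)) (by fun_prop)
            fun p hp => ⟨hKΩ hp.2, hIcc hp.1⟩)
      exact (hc.integrableOn_compact (isCompact_Icc.prod hK)).mono_set
        (prod_mono_left Ioc_subset_Icc_self)
  have hhW : ContinuousOn (fun z => h z * W (z, t)) Ω := hhc.mul (hslice hW2.continuousOn t ht)
  have hhW0 : ∀ z ∈ Ω, z ∉ K → h z * W (z, t) = 0 := fun z hz hzK => by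
    rw [hh0 z hz hzK, zero_mul]
  calc ∫⁻ z in Ω, ENNReal.ofReal (h z * W (z, t))
      = ENNReal.ofReal (∫ z in Ω, h z * W (z, t)) := by
        refine (ofReal_integral_eq_lintegral_ofReal
          (integrableOn_of_eq_zero_off_compact hΩ hK hKΩ hhW hhW0) ?_).symm
        exact (ae_restrict_mem hΩ.measurableSet).mono fun z hz =>
          mul_nonneg (expCutoff_nonneg _ _ _) (hWnn z hz t ht)
    _ = ENNReal.ofReal (∫ s in Ioc 0 t, ∫ z in K, h z * W' (z, s)) := by
        rw [hKeq hhW0, hfub]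
    _ ≤ ∫⁻ s in Ioc 0 t, ENNReal.ofReal (∫ z in K, h z * W' (z, s)) :=
        ofReal_integral_le_lintegral _ _
    _ ≤ ∫⁻ s in Ioc 0 t, ENNReal.ofReal Λ * ∫⁻ z in Ω, ENNReal.ofReal (y z * W (z, s)) := by
        refine setLIntegral_mono' measurableSet_Ioc fun s hs => ?_
        refine (ENNReal.ofReal_le_ofReal (hspace s hs)).trans ?_
        rw [ENNReal.ofReal_mul hΛ0]
        gcongr
        exact (ofReal_integral_le_lintegral _ _).trans (lintegral_mono_set hKΩ)
    _ = _ := by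
        rw [lintegral_const_mul' _ _ ENNReal.ofReal_ne_top, ENNReal.ofReal_eq_coe_nnreal hΛ0]
        rfl

/-! ### The maximum principle -/

/-- The maximum principle for supersolutions along the normalized Kähler–Ricci flow. -/
theorem nonneg_of_supersolution (Ω : Set (Fin n → ℂ)) (r : (Fin n → ℂ) → ℝ)
    (hr : IsStrictlyPshDefiningFunction Ω r)
    (T : EReal) (hT : 0 < T)
    (g : (Fin n → ℂ) → ℝ → ℝ)
    (hflow : IsKahlerRicciFlow Ω r T g)
    (hquasi : IsQuasiIsometric Ω r T g)
    (f : (Fin n → ℂ) → ℝ → ℝ)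
    (hf : ContDiffOn ℝ ∞ (fun p : (Fin n → ℂ) × ℝ => f p.1 p.2) (Ω ×ˢ timeInterval T))
    (hsuper : ∀ t ∈ timeInterval T, ∀ z ∈ Ω, f z t ≤ 0 →
      0 ≤ derivWithin (fun s => f z s) (timeInterval T) t -
        laplacian (metric g t) (fun w => f w t) z)
    (b : ℝ) (hb : 0 < b)
    (hgrowth : ∫⁻ t in timeInterval T, ∫⁻ z,
        ENNReal.ofReal ((-r z) ^ b * (-min (f z t) 0) ^ 2)
          ∂(volumeForm Ω (metric g t)) < ⊤)
    (hinit : ∀ z ∈ Ω, 0 ≤ f z 0) :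
    ∀ t ∈ timeInterval T, ∀ z ∈ Ω, 0 ≤ f z t := by
  have hΩ := hr.isOpen
  -- The weight is the cube of `e^{-aφ}`, so `a = b/3` makes it `(-r)^b`.
  have ha : 0 < b / 3 := by positivity
  obtain ⟨c, hc⟩ := exists_lintegral_expCutoff_le hr hT hflow hquasi hf hsuper hinit ha
  have hφc : ContinuousOn (refPotential r) Ω := continuousOn_of_forall_continuousAt fun z hz =>
    (hr.contDiffAt_refPotential hz).continuousAt
  have hDpos : ∀ z ∈ Ω, ∀ s ∈ timeInterval T, 0 < (metric g s z).det.re := fun z hz s hs =>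
    det_re_pos (hflow.posDef s hs z hz)
  have hDc : ∀ s ∈ timeInterval T, ContinuousOn (fun z => (metric g s z).det.re) Ω := fun s hs =>
    (hflow.contDiffOn_det hΩ hT).continuousOn.comp (f := fun z => (z, s)) (by fun_prop)
      fun z hz => ⟨hz, hs⟩
  have hfc : ∀ s ∈ timeInterval T, ContinuousOn (fun z => f z s) Ω := fun s hs =>
    hf.continuousOn.comp (f := fun z => (z, s)) (by fun_prop) fun z hz => ⟨hz, hs⟩
  have hVc : ∀ s ∈ timeInterval T,
      ContinuousOn (fun z => negPenalty (f z s) * (metric g s z).det.re) Ω := fun s hs =>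
    (contDiff_negPenalty.continuous.comp_continuousOn (hfc s hs)).mul (hDc s hs)
  have hyr : ∀ z ∈ Ω, Real.exp (-(b / 3) * refPotential r z) ^ 3 = (-r z) ^ b := fun z hz => by
    rw [Real.rpow_def_of_pos (neg_pos.2 (hr.neg hz)), ← Real.exp_nat_mul, refPotential]
    congr 1
    push_cast
    ring
  set E : ℝ → ENNReal := fun s => ∫⁻ z in Ω,
    ENNReal.ofReal (Real.exp (-(b / 3) * refPotential r z) ^ 3 *
      (negPenalty (f z s) * (metric g s z).det.re)) with hE
  -- `E` omits the factor `2^n ≥ 1` of the volume form and replaces the square of the negative part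
  -- by the smaller penalty.
  have hEle : ∀ s ∈ timeInterval T, E s ≤ ∫⁻ z, ENNReal.ofReal ((-r z) ^ b * (-min (f z s) 0) ^ 2)
      ∂(volumeForm Ω (metric g s)) := by
    intro s hs
    have hm1 : AEMeasurable (fun z => ENNReal.ofReal ((2 : ℝ) ^ n * (metric g s z).det.re))
        (volume.restrict Ω) :=
      ((continuousOn_const.mul (hDc s hs)).aemeasurable hΩ.measurableSet).ennreal_ofReal
    rw [volumeForm, lintegral_withDensity_eq_lintegral_mul_non_measurable₀ _ hm1
      (Eventually.of_forall fun z => ENNReal.ofReal_lt_top)]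
    refine setLIntegral_mono' hΩ.measurableSet fun z hz => ?_
    have hD := hDpos z hz s hs
    rw [Pi.mul_apply, ← ENNReal.ofReal_mul (by positivity), hyr z hz]
    refine ENNReal.ofReal_le_ofReal ?_
    have h1 : 0 ≤ (-r z) ^ b := Real.rpow_nonneg (neg_pos.2 (hr.neg hz)).le b
    have h2 : (1 : ℝ) ≤ 2 ^ n := one_le_pow₀ (by norm_num)
    have h3 := mul_le_mul_of_nonneg_left (negPenalty_le (f z s)) (mul_nonneg h1 hD.le)
    have h4 : 0 ≤ (metric g s z).det.re * ((-r z) ^ b * (-min (f z s) 0) ^ 2) := by positivity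
    have h5 := mul_le_mul_of_nonneg_right h2 h4
    linarith
  have hEfin : ∀ t ∈ timeInterval T, ∫⁻ s in Ioc 0 t, E s < ⊤ := fun t ht =>
    (((setLIntegral_mono' measurableSet_Ioc fun s hs =>
      hEle s (Icc_subset_timeInterval ht ⟨hs.1.le, hs.2⟩)).trans (lintegral_mono_set
        (Ioc_subset_Icc_self.trans (Icc_subset_timeInterval ht)))).trans_lt hgrowth)
  have hEgr : ∀ t ∈ timeInterval T, E t ≤ c * ∫⁻ s in Ioc 0 t, E s := by
    intro t ht
    have hlim : ∀ z, liminf (fun k : ℕ => ENNReal.ofReal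
        (expCutoff (b / 3) (1 / ((k : ℝ) + 1)) (refPotential r z) *
          (negPenalty (f z t) * (metric g t z).det.re))) atTop =
        ENNReal.ofReal (Real.exp (-(b / 3) * refPotential r z) ^ 3 *
          (negPenalty (f z t) * (metric g t z).det.re)) := fun z =>
      (ENNReal.tendsto_ofReal ((tendsto_expCutoff _ _).mul_const _)).liminf_eq
    have e : E t = ∫⁻ z in Ω, liminf (fun k : ℕ => ENNReal.ofReal
        (expCutoff (b / 3) (1 / ((k : ℝ) + 1)) (refPotential r z) *
          (negPenalty (f z t) * (metric g t z).det.re))) atTop :=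
      lintegral_congr fun z => (hlim z).symm
    rw [e]
    -- Fatou's lemma for `ε = 1/(k+1)`. `E t` may a priori be infinite at a given time; only its
    -- time integral is known to be finite.
    refine (lintegral_liminf_le' fun k => ?_).trans ?_
    · exact ((((contDiff_expCutoff _ _).continuous.comp_continuousOn hφc).mul
        (hVc t ht)).aemeasurable hΩ.measurableSet).ennreal_ofReal
    · exact liminf_le_of_frequently_le' (Frequently.of_forall fun k =>
        hc _ Nat.one_div_pos_of_nat t ht)
  intro t ht
  have hE0 : E t = 0 := by
    refine le_antisymm ?_ zero_le
    rw [← mul_zero (c : ENNReal), ← lintegral_Ioc_eq_zero_of_le_lintegral ht.1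
      (fun s hs => hEgr s (Icc_subset_timeInterval ht hs)) (hEfin t ht)]
    exact hEgr t ht
  intro z hz
  by_contra! hneg
  have hcont : ContinuousOn (fun z => ENNReal.ofReal
      (Real.exp (-(b / 3) * refPotential r z) ^ 3 *
        (negPenalty (f z t) * (metric g t z).det.re))) Ω :=
    ENNReal.continuous_ofReal.comp_continuousOn
      ((((continuousOn_const.mul hφc).rexp).pow 3).mul (hVc t ht))
  have hae := (lintegral_eq_zero_iff' (hcont.aemeasurable hΩ.measurableSet)).1 hE0
  -- A continuous function vanishing almost everywhere on an open set vanishes at every point of it.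
  have hzero := Measure.eqOn_open_of_ae_eq hae hΩ hcont continuousOn_const hz
  have hpos : 0 < Real.exp (-(b / 3) * refPotential r z) ^ 3 *
      (negPenalty (f z t) * (metric g t z).det.re) :=
    mul_pos (by positivity) (mul_pos (negPenalty_pos hneg) (hDpos z hz t ht))
  exact (ENNReal.ofReal_pos.2 hpos).ne' hzero

end KRFMax

end

theorem theoremT {n : ℕ} (Ω : Set (Fin n → ℂ)) (r : (Fin n → ℂ) → ℝ)
    (hr : KRFMax.IsStrictlyPshDefiningFunction Ω r)
    (T : EReal) (hT : 0 < T)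
    (g : (Fin n → ℂ) → ℝ → ℝ)
    (hflow : KRFMax.IsKahlerRicciFlow Ω r T g)
    (hquasi : KRFMax.IsQuasiIsometric Ω r T g)
    (f : (Fin n → ℂ) → ℝ → ℝ)
    (hf : ContDiffOn ℝ ∞ (fun p : (Fin n → ℂ) × ℝ => f p.1 p.2) (Ω ×ˢ KRFMax.timeInterval T))
    (hsuper : ∀ t ∈ KRFMax.timeInterval T, ∀ z ∈ Ω, f z t ≤ 0 →
      0 ≤ derivWithin (fun s => f z s) (KRFMax.timeInterval T) t -
        KRFMax.laplacian (KRFMax.metric g t) (fun w => f w t) z)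
    (b : ℝ) (hb : 0 < b)
    (hgrowth : ∫⁻ t in KRFMax.timeInterval T, ∫⁻ z,
        ENNReal.ofReal ((-r z) ^ b * (-min (f z t) 0) ^ 2)
          ∂(KRFMax.volumeForm Ω (KRFMax.metric g t)) < ⊤)
    (hinit : ∀ z ∈ Ω, 0 ≤ f z 0) :
    ∀ t ∈ KRFMax.timeInterval T, ∀ z ∈ Ω, 0 ≤ f z t :=
  KRFMax.nonneg_of_supersolution Ω r hr T hT g hflow hquasi f hf hsuper b hb hgrowth hinit
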